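/- Let $n\ge 0$ and let $c:\mathbb R^n\to\mathbb R\cup\{+\infty\}$ be a proper, lower semicontinuous (equivalently, closed) convex function; $\mathrm{dom}\,f=\{x : f(x)<+\infty\}$ denotes the effective domain of an extended-real-valued function $f$. Order $\mathbb R^n$ coordinatewise, with $x\wedge y$, $x\vee y$ the coordinatewise minimum and maximum, and $x^+=x\vee 0$, $x^-=(-x)\vee 0$. Write $f^*(p)=\sup_{q\in\mathbb R^n}\{p^\top q-f(q)\}$ for the convex conjugate and $\partial f(s)=\{p : f^*(p)+f(s)=p^\top s\}$ for the subdifferential. For functions $f,g$, write $f\le_Q g$ if for all $x\in\mathrm{dom}\,f$, $y\in\mathrm{dom}\,g$ and $\delta_1\in[0,(x-y)^+]$ there is $\delta_2\in[0,(x-y)^-]$ such that $$f(x-(\delta_1-\delta_2))+g(y+(\delta_1-\delta_2))\le f(x)+g(y).$$ For sets $X,Y\subseteq\mathbb R^I$ ($I$ finite), write $X\le_Q Y$ if for all $x\in X$, $y\in Y$ and $\delta_1\in[0,(x-y)^+]$ there is $\delta_2\in[0,(x-y)^-]$ such that $x-(\delta_1-\delta_2)\in X$ and $y+(\delta_1-\delta_2)\in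 Y$. A function $f$ is submodular if $f(p\wedge p')+f(p\vee p')\le f(p)+f(p')$ for all $p,p'\in\mathrm{dom}\,f$. For $I\subseteq\{1,\dots,n\}$ let $\pi_I$ be the projection of $\mathbb R^n$ onto $\mathbb R^I$, and let $\{p=p'\}$ denote the set of indices $i$ with $p_i=p'_i$. For $p,\bar q\in\mathbb R^n$ let $$r(p,\bar q)=\bar q-\operatorname*{argmax}_{q\le\bar q}\{p^\top q-c(q)\},$$ where the argmax is the (possibly empty) set of $q\in\mathrm{dom}\,c$ with $q\le\bar q$ at which $p^\top q-c(q)$ attains its maximum over $\{q\le\bar q\}$; in particular it is empty if no $q\le\bar q$ lies in $\mathrm{dom}\,c$. Then the following four assertions are equivalent: 1. $c$ is exchangeable, i.e. $c\le_Q c$; 2. $c^*$ is submodular; 3. for all $p\le p'$, $\ \pi_{\{p=p'\}}(\partial c^*(p'))\le_Q\pi_{\{p=p'\}}(\partial c^*(p))$; 4. for all $p\le p'$ and $\bar q\le\bar q'$, $\ \pi_{\{p=p'\}}(r(p,\bar q))\le_Q\pi_{\{p=p'\}}(r(p',\bar q'))$. -/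

import Mathlib

open scoped Matrix

namespace ExchangeMCS

noncomputable section

variable {ι : Type*}

/-- The effective domain `{x | f x < +∞}` of an extended-real-valued function. -/
def effDom (f : (ι → ℝ) → EReal) : Set (ι → ℝ) := {x | f x < ⊤}

/-- A proper function: it never takes the value `-∞`, and it is not identically `+∞`. -/
def IsProper (f : (ι → ℝ) → EReal) : Prop :=
  (∀ x, f x ≠ ⊥) ∧ (effDom f).Nonempty

/-- Convexity of an extended-real-valued function: its epigraph is convex. -/
def IsConvex (f : (ι → ℝ) → EReal) : Prop :=
  Convex ℝ {z : (ι → ℝ) × ℝ | f z.1 ≤ (z.2 : EReal)}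

/-- The Legendre transform `f*(p) = sup_q {pᵀq - f(q)}`. -/
def conj [Fintype ι] (f : (ι → ℝ) → EReal) (p : ι → ℝ) : EReal :=
  ⨆ q : ι → ℝ, ((p ⬝ᵥ q : ℝ) : EReal) - f q

/-- The subdifferential `∂f(s) = {p | f*(p) + f(s) = pᵀs}`. -/
def subdiff [Fintype ι] (f : (ι → ℝ) → EReal) (s : ι → ℝ) : Set (ι → ℝ) :=
  {p | conj f p + f s = ((p ⬝ᵥ s : ℝ) : EReal)}

/-- The Q-order `f ≤_Q g` on functions. -/
def FunQLE (f g : (ι → ℝ) → EReal) : Prop :=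
  ∀ x ∈ effDom f, ∀ y ∈ effDom g, ∀ δ₁ ∈ Set.Icc 0 (x - y)⁺, ∃ δ₂ ∈ Set.Icc 0 (x - y)⁻,
    f (x - (δ₁ - δ₂)) + g (y + (δ₁ - δ₂)) ≤ f x + g y

/-- A function is exchangeable if it is below itself in the Q-order. -/
def IsExchangeable (f : (ι → ℝ) → EReal) : Prop := FunQLE f f

/-- The P-order `f ≤_P g` on functions. -/
def FunPLE (f g : (ι → ℝ) → EReal) : Prop :=
  ∀ x ∈ effDom f, ∀ y ∈ effDom g, f (x ⊓ y) + g (x ⊔ y) ≤ f x + g y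

/-- A function is submodular if it is below itself in the P-order. -/
def IsSubmodular (f : (ι → ℝ) → EReal) : Prop := FunPLE f f

/-- The Q-order `X ≤_Q Y` on sets. -/
def SetQLE (X Y : Set (ι → ℝ)) : Prop :=
  ∀ x ∈ X, ∀ y ∈ Y, ∀ δ₁ ∈ Set.Icc 0 (x - y)⁺, ∃ δ₂ ∈ Set.Icc 0 (x - y)⁻,
    x - (δ₁ - δ₂) ∈ X ∧ y + (δ₁ - δ₂) ∈ Y

/-- The projection `π_I(X) ⊆ ℝ^I` of a set `X` onto the coordinates in `I`. -/
def proj (I : Set ι) (X : Set (ι → ℝ)) : Set (I → ℝ) :=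
  (fun x (i : I) => x i) '' X

/-- The set `{p = p'}` of coordinates in which `p` and `p'` agree. -/
def agree (p p' : ι → ℝ) : Set ι := {i | p i = p' i}

/-- The set `argmax_{q ≤ q̄} {pᵀq - c(q)}`. Maximizers are points of the domain of `c`; in
particular the set is empty when no `q ≤ q̄` lies in the domain. -/
def demand [Fintype ι] (c : (ι → ℝ) → EReal) (p qbar : ι → ℝ) : Set (ι → ℝ) :=
  {q | q ≤ qbar ∧ q ∈ effDom c ∧
    ∀ q' ≤ qbar, ((p ⬝ᵥ q' : ℝ) : EReal) - c q' ≤ ((p ⬝ᵥ q : ℝ) : EReal) - c q}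

/-- The rejected quantities `r(p, q̄) = q̄ - argmax_{q ≤ q̄} {pᵀq - c(q)}`. -/
def rejected [Fintype ι] (c : (ι → ℝ) → EReal) (p qbar : ι → ℝ) : Set (ι → ℝ) :=
  (fun q => qbar - q) '' demand c p qbar

end

end ExchangeMCS

namespace ExchangeMCS

/-! The cycle is 2 ⇒ 1 ⇒ 4 ⇒ 3 ⇒ 2. If exchange fails at x, y, δ₁, the compact convex set of
candidate exchanges can be separated from the epigraph of (u, v) ↦ c(u) + c(v). The slopes p, p' of
the resulting affine minorant contradict submodularity of c* through Fenchel–Young at (p ∨ p', x)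
and (p ∧ p', y) (`isExchangeable_of_conj_isSubmodular`). Exchanging between optimal bundles cannot
lower total surplus, so both stay optimal (`IsExchangeable.rejected_setQLE`). With capacity x ∨ y
the constraint excludes neither x nor y, which gives 3 (`subdiff_setQLE_of_rejected`).

The hard implication is 3 ⇒ 2: φ = c* need not be differentiable, and its domain may have empty
interior and is not known to be a lattice. The core is `SubExch.sub_mem_and_le`. For a subgradient x
at a relative interior point p, and d, w ≥ 0 with disjoint supports and p + d - w in the domain, φ(p
- w) + x·d ≤ φ(p + d - w). To reach p - w, minimise φ(z) + k ∑ zᵢ over the box [p - w, p]. Lagrange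
multipliers give a subgradient at z that is ≤ -k wherever z is above the lower face, and exchange
with x makes it ≥ x wherever w vanishes. Let k → ∞. Telescoping these inequalities from p to p + d
gives submodularity from relative interior points, and closedness extends it to the whole domain. -/

open Filter Topology

/-! ### Affine minorants of closed convex functions. -/

section Separation

variable {V : Type*} [NormedAddCommGroup V] [NormedSpace ℝ V]

/-- The epigraph over `C` of a real function. -/
def epi (C : Set V) (φ : V → ℝ) : Set (V × ℝ) := {z | z.1 ∈ C ∧ φ z.1 ≤ z.2}

/-- Strict separation of a compact convex slice from a closed convex epigraph. -/
lemma exists_separation {C : Set V} {φ : V → ℝ} (hφ : ConvexOn ℝ C φ)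
    (hcl : IsClosed (epi C φ)) (hne : C.Nonempty) {K : Set V} (hK : IsCompact K)
    (hKc : Convex ℝ K) {M : ℝ} (h : ∀ k ∈ K, k ∈ C → M < φ k) :
    ∃ (l : V →L[ℝ] ℝ) (τ u v : ℝ), 0 ≤ τ ∧ u < v ∧ (∀ k ∈ K, l k + τ * M < u) ∧
      ∀ a ∈ C, v < l a + τ * φ a := by
  have hconv : Convex ℝ (epi C φ) := hφ.convex_epigraph
  have hdisj : Disjoint (K ×ˢ {M}) (epi C φ) := by
    rw [Set.disjoint_left]
    rintro ⟨k, r⟩ ⟨hk, hr⟩ ⟨hC, hle⟩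
    simp only [Set.mem_singleton_iff] at hr hk hC hle
    subst hr
    exact absurd hle (not_le.2 (h k hk hC))
  obtain ⟨f, u, v, hs, huv, ht⟩ := geometric_hahn_banach_compact_closed
    (hKc.prod (convex_singleton M)) (hK.prod isCompact_singleton) hconv hcl hdisj
  have hf : ∀ a r, f (a, r) = f.comp (ContinuousLinearMap.inl ℝ V ℝ) a + f (0, 1) * r := by
    intro a r
    have : ((a, r) : V × ℝ) = (a, 0) + r • (0, 1) := by simp
    rw [this, map_add, map_smul]
    simp [mul_comm]
  refine ⟨f.comp (ContinuousLinearMap.inl ℝ V ℝ), f (0, 1), u, v, ?_, huv, ?_, ?_⟩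
  -- The epigraph is unbounded upwards, so a negative vertical slope would violate the lower bound
  -- `v` at a high enough point.
  · by_contra! hneg
    obtain ⟨a, ha⟩ := hne
    set B := f.comp (ContinuousLinearMap.inl ℝ V ℝ) a
    set r := max (φ a) ((v - B) / f (0, 1))
    have h1 := ht (a, r) ⟨ha, le_max_left _ _⟩
    rw [hf] at h1
    have h2 : (v - B) / f (0, 1) ≤ r := le_max_right _ _
    rw [div_le_iff_of_neg hneg] at h2
    have h3 : f.comp (ContinuousLinearMap.inl ℝ V ℝ) a = B := rfl
    nlinarith
  · intro k hk
    rw [← hf]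
    exact hs _ ⟨hk, rfl⟩
  · intro a ha
    rw [← hf]
    exact ht _ ⟨ha, le_rfl⟩

/-- Separating a point just below the graph from the epigraph cannot give a vertical hyperplane,
because that point lies over `C`. -/
lemma exists_affine_le {C : Set V} {φ : V → ℝ} (hφ : ConvexOn ℝ C φ)
    (hcl : IsClosed (epi C φ)) (hne : C.Nonempty) :
    ∃ (l : V →L[ℝ] ℝ) (b : ℝ), ∀ a ∈ C, l a - b ≤ φ a := by
  obtain ⟨x, hx⟩ := hne
  obtain ⟨l, τ, u, v, hτ, huv, hK, hC⟩ := exists_separation hφ hcl ⟨x, hx⟩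
    (isCompact_singleton (x := x)) (convex_singleton x) (M := φ x - 1)
    (by rintro k rfl _; linarith)
  have h1 := hK x rfl
  have h2 := hC x hx
  have hpos : 0 < τ := by
    rcases hτ.lt_or_eq with h | h
    · exact h
    · subst h; linarith
  refine ⟨-(τ⁻¹ • l), -(v / τ), fun a ha => ?_⟩
  have h3 := hC a ha
  have : (-(τ⁻¹ • l)) a - -(v / τ) = (v - l a) / τ := by
    simp; field_simp; ring
  rw [this, div_le_iff₀ hpos]
  linarith

/-- A closed convex function exceeding `M` on a compact convex set has an affine minorant which
exceeds `M` on that set. -/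
lemma exists_affine_le_and_lt {C : Set V} {φ : V → ℝ} (hφ : ConvexOn ℝ C φ)
    (hcl : IsClosed (epi C φ)) (hne : C.Nonempty) {K : Set V} (hK : IsCompact K)
    (hKc : Convex ℝ K) {M : ℝ} (h : ∀ k ∈ K, k ∈ C → M < φ k) :
    ∃ (l : V →L[ℝ] ℝ) (b : ℝ), (∀ a ∈ C, l a - b ≤ φ a) ∧ ∀ k ∈ K, M < l k - b := by
  obtain ⟨l, τ, u, v, hτ, huv, hlK, hlC⟩ := exists_separation hφ hcl hne hK hKc h
  rcases hτ.lt_or_eq with hpos | h0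
  · have key : ∀ a, (-(τ⁻¹ • l)) a - -(v / τ) = (v - l a) / τ := by
      intro a; simp; field_simp; ring
    refine ⟨-(τ⁻¹ • l), -(v / τ), fun a ha => ?_, fun k hk => ?_⟩
    · rw [key, div_le_iff₀ hpos]
      linarith [hlC a ha]
    · rw [key, lt_div_iff₀ hpos]
      linarith [hlK k hk]
  -- The hyperplane is vertical. Tilting any affine minorant by a large multiple `N` of it costs
  -- nothing on `C` and gains at least `N * (v - u)` on `K`.
  · subst h0
    obtain ⟨l₀, b₀, h₀⟩ := exists_affine_le hφ hcl hne
    obtain ⟨B, hB⟩ := (hK.image l₀.continuous).bddBelow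
    have hB' : ∀ k ∈ K, B ≤ l₀ k := fun k hk => hB ⟨k, hk, rfl⟩
    obtain ⟨N, hN⟩ := exists_nat_gt ((M + b₀ - B) / (v - u))
    rw [div_lt_iff₀ (by linarith)] at hN
    have hN0 : (0 : ℝ) ≤ N := Nat.cast_nonneg N
    refine ⟨l₀ - (N : ℝ) • l, b₀ - N * v, fun a ha => ?_, fun k hk => ?_⟩
    · have h1 := h₀ a ha
      have h2 := hlC a ha
      simp only [_root_.sub_apply, _root_.smul_apply, smul_eq_mul]
      nlinarith
    · have h1 := hB' k hk
      have h2 := hlK k hk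
      simp only [_root_.sub_apply, _root_.smul_apply, smul_eq_mul]
      nlinarith

end Separation

/-! ### Relative interior and Lagrange multipliers without strict feasibility. -/

section Multipliers

variable {V : Type*} [AddCommGroup V] [Module ℝ V]

/-- Algebraic relative interior: every segment of `C` ending at `p` extends beyond `p`. -/
def RelInt (C : Set V) (p : V) : Prop := p ∈ C ∧ ∀ v ∈ C, ∃ ε > (0 : ℝ), p - ε • (v - p) ∈ C

lemma RelInt.combo {C : Set V} (hC : Convex ℝ C) {p v : V} (hp : RelInt C p) (hv : v ∈ C)
    {t : ℝ} (ht : 0 < t) (ht1 : t ≤ 1) : RelInt C (v + t • (p - v)) := by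
  have hmem : ∀ x ∈ C, ∀ y ∈ C, ∀ s : ℝ, 0 ≤ s → s ≤ 1 → x + s • (y - x) ∈ C := by
    intro x hx y hy s hs hs1
    exact hC.add_smul_sub_mem hx hy ⟨hs, hs1⟩
  refine ⟨hmem v hv p hp.1 t ht.le ht1, fun u hu => ?_⟩
  obtain ⟨ε, hε, h⟩ := hp.2 _ (hmem v hv u hu t ht.le ht1)
  obtain ⟨ε', hε', h'⟩ := hp.2 u hu
  have hpos : 0 < 1 + ε' * (1 - t) := by nlinarith
  -- This is where the ray from `u` through the combination meets the segment from `v` to `p - ε' •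
  -- (u - p)`.
  refine ⟨t * ε' / (1 + ε' * (1 - t)), by positivity, ?_⟩
  have := hmem v hv _ h' (t / (1 + ε' * (1 - t))) (by positivity)
    (by rw [div_le_one hpos]; nlinarith)
  convert this using 1
  match_scalars <;> field_simp <;> ring

lemma affine_extend (a : V →ᵃ[ℝ] ℝ) (p v : V) (ε : ℝ) :
    a (p - ε • (v - p)) = a p - ε * (a v - a p) := by
  have : p - ε • (v - p) = AffineMap.lineMap p v (-ε) := by
    simp [AffineMap.lineMap_apply]; module
  rw [this, AffineMap.apply_lineMap]
  simp [AffineMap.lineMap_apply]; ring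

lemma RelInt.inter_affine_eq_zero {C : Set V} {p : V} (hp : RelInt C p) (a : V →ᵃ[ℝ] ℝ)
    (ha : a p = 0) : RelInt (C ∩ {v | a v = 0}) p := by
  refine ⟨⟨hp.1, ha⟩, fun v hv => ?_⟩
  obtain ⟨ε, hε, h⟩ := hp.2 v hv.1
  refine ⟨ε, hε, h, ?_⟩
  simp [affine_extend, ha, hv.2.out]

lemma affine_combo (a : V →ᵃ[ℝ] ℝ) (u v : V) {s t : ℝ} (hst : s + t = 1) :
    a (s • u + t • v) = s * a u + t * a v := by
  have : s • u + t • v = AffineMap.lineMap u v t := by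
    rw [AffineMap.lineMap_apply_module, ← hst]; simp
  rw [this, AffineMap.apply_lineMap, AffineMap.lineMap_apply_module, ← hst]
  simp

/-- Lagrange multiplier for one affine equality constraint through a relative interior point. -/
lemma exists_multiplier_eq {C : Set V} {p : V} (hp : RelInt C p) {g : V → ℝ}
    (hg : ConvexOn ℝ C g) (a : V →ᵃ[ℝ] ℝ) (ha : a p = 0)
    (h : ∀ v ∈ C, a v = 0 → 0 ≤ g v) : ∃ μ : ℝ, ∀ v ∈ C, 0 ≤ g v + μ * a v := by
  by_cases hall : ∀ v ∈ C, a v = 0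
  · exact ⟨0, fun v hv => by simpa using h v hv (hall v hv)⟩
  push Not at hall
  obtain ⟨v₀, hv₀, hne⟩ := hall
  obtain ⟨ε, hε, hv₁⟩ := hp.2 v₀ hv₀
  have hav₁ := affine_extend a p v₀ ε
  rw [ha] at hav₁
  obtain ⟨x, hx, hxpos⟩ : ∃ x ∈ C, 0 < a x := by
    rcases lt_or_gt_of_ne hne with h1 | h1
    · exact ⟨_, hv₁, by rw [hav₁]; nlinarith⟩
    · exact ⟨_, hv₀, h1⟩
  obtain ⟨y, hy, hyneg⟩ : ∃ y ∈ C, a y < 0 := by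
    rcases lt_or_gt_of_ne hne with h1 | h1
    · exact ⟨_, hv₀, h1⟩
    · exact ⟨_, hv₁, by rw [hav₁]; nlinarith⟩
  -- The segment from `x` to `y` crosses `a = 0`, where `g` is nonnegative. Hence every lower bound
  -- on `μ` is below every upper bound, and the supremum of the lower bounds works.
  have cross : ∀ x ∈ C, 0 < a x → ∀ y ∈ C, a y < 0 → -(g x) / a x ≤ g y / -(a y) := by
    intro x hx hxp y hy hyn
    have hs : 0 < a x - a y := by linarith
    have h1 : (-a y) / (a x - a y) + a x / (a x - a y) = 1 := by field_simp; ring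
    have h2 := hg.2 hx hy (div_nonneg (by linarith) hs.le) (div_nonneg hxp.le hs.le) h1
    have h3 := h _ (hg.1 hx hy (div_nonneg (by linarith : 0 ≤ -a y) hs.le)
      (div_nonneg hxp.le hs.le) h1) (by rw [affine_combo a _ _ h1]; field_simp; ring)
    have h4 := h3.trans h2
    simp only [smul_eq_mul] at h4
    have h5 : (-a y / (a x - a y)) * g x + a x / (a x - a y) * g y
        = (-a y * g x + a x * g y) / (a x - a y) := by ring
    rw [h5, le_div_iff₀ hs] at h4
    rw [div_le_div_iff₀ hxp (by linarith)]
    nlinarith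
  set S : Set ℝ := (fun x => -(g x) / a x) '' {x | x ∈ C ∧ 0 < a x}
  have hSne : S.Nonempty := ⟨_, x, ⟨hx, hxpos⟩, rfl⟩
  have hSb : BddAbove S := ⟨g y / -(a y), by
    rintro _ ⟨z, hz, rfl⟩; exact cross z hz.1 hz.2 y hy hyneg⟩
  refine ⟨sSup S, fun v hv => ?_⟩
  rcases lt_trichotomy (a v) 0 with hv' | hv' | hv'
  · have : sSup S ≤ g v / -(a v) := csSup_le hSne (by
      rintro _ ⟨z, hz, rfl⟩; exact cross z hz.1 hz.2 v hv hv')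
    rw [le_div_iff₀ (by linarith)] at this
    linarith
  · rw [hv']; simpa using h v hv hv'
  · have : -(g v) / a v ≤ sSup S := le_csSup hSb ⟨v, ⟨hv, hv'⟩, rfl⟩
    rw [div_le_iff₀ hv'] at this
    linarith

/-- Fritz John multipliers for finitely many affine inequality constraints. -/
lemma exists_fritz_john {J : Type*} [Fintype J] [DecidableEq J] (s : Finset J)
    (a : J → V →ᵃ[ℝ] ℝ) {C : Set V} (hne : C.Nonempty) {g : V → ℝ} (hg : ConvexOn ℝ C g)
    (h : ∀ v ∈ C, (∀ j ∈ s, a j v ≤ 0) → 0 ≤ g v) :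
    ∃ (τ : ℝ) (l : J → ℝ), 0 ≤ τ ∧ (∀ j ∈ s, 0 ≤ l j) ∧ (τ = 0 → ∃ j ∈ s, 0 < l j) ∧
      ∀ v ∈ C, 0 ≤ τ * g v + ∑ j ∈ s, l j * a j v := by
  -- Strict inequalities make `A` open; infeasibility of a negative value keeps the origin out of
  -- it. The multipliers are the coordinates of a functional separating the two.
  set A : Set (ℝ × (J → ℝ)) := {z | ∃ v ∈ C, g v < z.1 ∧ ∀ j ∈ s, a j v < z.2 j} with hA
  have hAo : IsOpen A := by
    have : A = ⋃ v ∈ C, ({z | g v < z.1} ∩ ⋂ j ∈ s, {z | a j v < z.2 j}) := by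
      ext z; simp [hA, and_left_comm]
    rw [this]
    refine isOpen_biUnion fun v _ => (isOpen_lt continuous_const continuous_fst).inter
      (isOpen_biInter_finset fun j _ => isOpen_lt continuous_const (by fun_prop))
  have hAc : Convex ℝ A := by
    rintro ⟨r, y⟩ ⟨v, hv, hr, hy⟩ ⟨r', y'⟩ ⟨v', hv', hr', hy'⟩ α β hα hβ hαβ
    refine ⟨α • v + β • v', hg.1 hv hv' hα hβ hαβ, ?_, fun j hj => ?_⟩
    · refine (hg.2 hv hv' hα hβ hαβ).trans_lt ?_
      simp only [smul_eq_mul, Prod.fst_add, Prod.smul_fst] at *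
      rcases hα.lt_or_eq with h1 | h1
      · nlinarith
      · have : β = 1 := by linarith
        subst this; subst h1; linarith
    · rw [affine_combo _ _ _ hαβ]
      have h1 := hy j hj
      have h2 := hy' j hj
      simp only [Prod.snd_add, Prod.smul_snd, Pi.add_apply, Pi.smul_apply, smul_eq_mul] at *
      rcases hα.lt_or_eq with h1 | h1
      · nlinarith
      · have : β = 1 := by linarith
        subst this; subst h1; linarith
  have h0 : (0 : ℝ × (J → ℝ)) ∉ A := by
    rintro ⟨v, hv, hgv, hav⟩
    exact absurd (h v hv fun j hj => (hav j hj).le) (not_le.2 hgv)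
  obtain ⟨f, hf⟩ := geometric_hahn_banach_open_point hAc hAo h0
  set τ := -f (1, 0)
  set l : J → ℝ := fun j => -f (0, Pi.single j 1)
  have hfe : ∀ r y, -f (r, y) = τ * r + ∑ j, l j * y j := by
    intro r y
    have e : ((r, y) : ℝ × (J → ℝ)) = r • (1, 0) + ∑ j, y j • ((0, Pi.single j 1) : ℝ × (J → ℝ)) := by
      ext1
      · simp [Prod.fst_sum]
      · ext i; simp [Prod.snd_sum, Finset.sum_apply, Pi.single_apply]
    rw [e, map_add, map_sum]
    simp only [map_smul, smul_eq_mul, τ, l, neg_add, neg_mul, Finset.sum_neg_distrib]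
    congr 2
    · ring
    · exact Finset.sum_congr rfl fun j _ => by ring
  have hpos : ∀ v ∈ C, ∀ (r : ℝ) (y : J → ℝ), g v < r → (∀ j ∈ s, a j v < y j) →
      0 < τ * r + ∑ j ∈ s, l j * y j := by
    intro v hv r y hr hy
    have := hf (r, fun j => if j ∈ s then y j else 0)
      ⟨v, hv, hr, fun j hj => by simpa [hj] using hy j hj⟩
    have e := hfe r (fun j => if j ∈ s then y j else 0)
    simp only [mul_ite, mul_zero, Finset.sum_ite_mem, Finset.univ_inter] at e
    rw [← e]
    have z : f 0 = 0 := map_zero f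
    linarith
  obtain ⟨v₀, hv₀⟩ := hne
  have hτ : 0 ≤ τ := by
    by_contra! hneg
    set R := ∑ j ∈ s, l j * (a j v₀ + 1)
    have h1 := hpos v₀ hv₀ (max (g v₀ + 1) (-R / τ)) (fun j => a j v₀ + 1)
      (lt_of_lt_of_le (by linarith) (le_max_left _ _)) (fun j _ => by linarith)
    have h2 := le_max_right (g v₀ + 1) (-R / τ)
    rw [div_le_iff_of_neg hneg] at h2
    have : ∑ j ∈ s, l j * (a j v₀ + 1) = R := rfl
    nlinarith
  have hl : ∀ j ∈ s, 0 ≤ l j := by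
    intro j hj
    by_contra! hneg
    set R := τ * (g v₀ + 1) + ∑ j ∈ s, l j * (a j v₀ + 1)
    have h1 := hpos v₀ hv₀ (g v₀ + 1)
      (fun i => (a i v₀ + 1) + if i = j then max 0 (-R / l j) else 0)
      (by linarith) (fun i _ => by
        have : (0 : ℝ) ≤ if i = j then max 0 (-R / l j) else 0 := by split_ifs <;> simp
        linarith)
    have h2 := le_max_right 0 (-R / l j)
    rw [div_le_iff_of_neg hneg] at h2
    simp only [mul_add (l _), Finset.sum_add_distrib, mul_ite, mul_zero, Finset.sum_ite_eq' s j,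
      hj, if_true] at h1
    have : τ * (g v₀ + 1) + ∑ j ∈ s, l j * (a j v₀ + 1) = R := rfl
    simp only [mul_add (l _), Finset.sum_add_distrib] at this
    nlinarith
  refine ⟨τ, l, hτ, hl, fun h0 => ?_, fun v hv => ?_⟩
  · by_contra! hcon
    have h1 := hpos v₀ hv₀ (g v₀ + 1) (fun j => a j v₀ + 1) (by linarith) (fun j _ => by linarith)
    rw [h0, Finset.sum_eq_zero] at h1
    · simp at h1
    · intro j hj
      rw [le_antisymm (hcon j hj) (hl j hj), zero_mul]
  · have hlim : Tendsto (fun ε : ℝ => τ * (g v + ε) + ∑ j ∈ s, l j * (a j v + ε)) (𝓝[>] 0)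
        (𝓝 (τ * (g v + 0) + ∑ j ∈ s, l j * (a j v + 0))) :=
      (Continuous.tendsto (by fun_prop) 0).mono_left nhdsWithin_le_nhds
    simp only [add_zero] at hlim
    refine ge_of_tendsto hlim ?_
    filter_upwards [self_mem_nhdsWithin] with ε hε
    have hε' : (0 : ℝ) < ε := hε
    exact (hpos v hv _ (fun j => a j v + ε) (by linarith) (fun j _ => by linarith)).le

/-- Lagrange multipliers for affine inequality constraints which hold at some relative interior
point; no strict feasibility is needed. -/
lemma exists_multipliers {J : Type*} [Fintype J] [DecidableEq J] (a : J → V →ᵃ[ℝ] ℝ) {p : V}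
    {g : V → ℝ} (s : Finset J) : ∀ {C : Set V}, RelInt C p → ConvexOn ℝ C g →
    (∀ j ∈ s, a j p ≤ 0) → (∀ v ∈ C, (∀ j ∈ s, a j v ≤ 0) → 0 ≤ g v) →
    ∃ l : J → ℝ, (∀ j ∈ s, 0 ≤ l j) ∧ ∀ v ∈ C, 0 ≤ g v + ∑ j ∈ s, l j * a j v := by
  induction s using Finset.strongInduction with
  | H s ih =>
  intro C hp hg hap h
  obtain ⟨τ, l, hτ, hl, hl0, hlC⟩ := exists_fritz_john s a ⟨p, hp.1⟩ hg h
  rcases hτ.lt_or_eq with hpos | h0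
  · refine ⟨fun j => l j / τ, fun j hj => div_nonneg (hl j hj) hτ, fun v hv => ?_⟩
    have h1 := div_nonneg (hlC v hv) hτ
    rw [add_div, mul_div_cancel_left₀ _ hpos.ne', Finset.sum_div] at h1
    simpa only [div_mul_eq_mul_div] using h1
  -- Degenerate case: the combination `∑ l j * a j` is nonnegative on `C` and zero at the relative
  -- interior point `p`, hence zero on all of `C`. Constraint `j₀` is tight at `p`; impose it as an
  -- equation and induct on the others.
  · obtain ⟨j₀, hj₀, hlj₀⟩ := hl0 h0.symm
    rw [← h0] at hlC
    simp only [zero_mul, zero_add] at hlC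
    have hterm : ∀ j ∈ s, l j * a j p ≤ 0 := fun j hj =>
      mul_nonpos_of_nonneg_of_nonpos (hl j hj) (hap j hj)
    have hsum0 : ∑ j ∈ s, l j * a j p = 0 :=
      le_antisymm (Finset.sum_nonpos hterm) (hlC p hp.1)
    have hj₀p : a j₀ p = 0 := by
      have := (Finset.sum_eq_zero_iff_of_nonpos hterm).1 hsum0 j₀ hj₀
      exact (mul_eq_zero.1 this).resolve_left hlj₀.ne'
    have hvan : ∀ v ∈ C, ∑ j ∈ s, l j * a j v = 0 := by
      intro v hv
      obtain ⟨ε, hε, h'⟩ := hp.2 v hv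
      have h1 := hlC _ h'
      simp only [affine_extend] at h1
      have e : ∑ j ∈ s, l j * (a j p - ε * (a j v - a j p))
          = (1 + ε) * ∑ j ∈ s, l j * a j p - ε * ∑ j ∈ s, l j * a j v := by
        rw [Finset.mul_sum, Finset.mul_sum, ← Finset.sum_sub_distrib]
        exact Finset.sum_congr rfl fun j _ => by ring
      rw [e, hsum0] at h1
      have h2 := hlC v hv
      nlinarith
    have hsub : C ∩ {v | a j₀ v = 0} ⊆ C := Set.inter_subset_left
    have hconv : Convex ℝ (C ∩ {v | a j₀ v = 0}) := by
      intro x hx y hy α β hα hβ hαβ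
      refine ⟨hg.1 hx.1 hy.1 hα hβ hαβ, ?_⟩
      simp [affine_combo _ _ _ hαβ, hx.2.out, hy.2.out]
    obtain ⟨m, hm, hmC⟩ := ih (s.erase j₀) (Finset.erase_ssubset hj₀)
      (hp.inter_affine_eq_zero (a j₀) hj₀p) (hg.subset hsub hconv)
      (fun j hj => hap j (Finset.mem_of_mem_erase hj))
      (fun v hv hav => h v hv.1 fun j hj => by
        by_cases hjj : j = j₀
        · subst hjj; exact hv.2.out.le
        · exact hav j (Finset.mem_erase.2 ⟨hjj, hj⟩))
    have hG : ConvexOn ℝ C (fun v => g v + ∑ j ∈ s.erase j₀, m j * a j v) := by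
      refine hg.add ⟨hg.1, fun x hx y hy α β hα hβ hαβ => le_of_eq ?_⟩
      simp only [affine_combo _ _ _ hαβ, smul_eq_mul]
      rw [Finset.mul_sum, Finset.mul_sum, ← Finset.sum_add_distrib]
      exact Finset.sum_congr rfl fun j _ => by ring
    obtain ⟨μ, hμ⟩ := exists_multiplier_eq hp hG (a j₀) hj₀p (fun v hv hv0 => hmC v ⟨hv, hv0⟩)
    -- The equality multiplier `μ` may be negative. Adding `N` times the vanishing combination
    -- repairs its sign without changing any value on `C`.
    set N := |μ| / l j₀
    have hN : 0 ≤ N := by positivity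
    refine ⟨fun j => (if j = j₀ then μ else m j) + N * l j, fun j hj => ?_, fun v hv => ?_⟩
    · by_cases hjj : j = j₀
      · subst hjj
        have : N * l j = |μ| := by simp only [N]; field_simp
        simp only [if_true, this]
        linarith [neg_abs_le μ]
      · simp only [hjj, if_false]
        have := hm j (Finset.mem_erase.2 ⟨hjj, hj⟩)
        have := hl j hj
        positivity
    · have e : ∑ j ∈ s, ((if j = j₀ then μ else m j) + N * l j) * a j v
          = (∑ j ∈ s.erase j₀, m j * a j v) + μ * a j₀ v + N * ∑ j ∈ s, l j * a j v := by
        simp only [add_mul, Finset.sum_add_distrib, Finset.mul_sum, mul_assoc]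
        congr 1
        rw [← Finset.sum_erase_add _ _ hj₀]
        simp only [if_true]
        congr 1
        refine Finset.sum_congr rfl fun j hj => ?_
        rw [if_neg (Finset.ne_of_mem_erase hj)]
      rw [e, hvan v hv]
      have := hμ v hv
      linarith

end Multipliers

/-! ### Reflection, and closedness for sums of two values. -/

section Symmetry

variable {V : Type*} [NormedAddCommGroup V] [NormedSpace ℝ V] {C : Set V} {φ : V → ℝ}

omit [NormedSpace ℝ V] in
lemma epi_neg_isClosed (hcl : IsClosed (epi C φ)) :
    IsClosed (epi (-C) (fun v => φ (-v))) :=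
  hcl.preimage (f := fun z : V × ℝ => (-z.1, z.2)) (by fun_prop)

lemma convexOn_neg (hφ : ConvexOn ℝ C φ) :
    ConvexOn ℝ (-C) (fun v => φ (-v)) :=
  hφ.comp_linearMap (-LinearMap.id : V →ₗ[ℝ] V)

lemma RelInt.neg {p : V} (hp : RelInt C p) : RelInt (-C) (-p) := by
  refine ⟨by simpa using hp.1, fun v hv => ?_⟩
  obtain ⟨ε, hε, h⟩ := hp.2 (-v) hv
  refine ⟨ε, hε, ?_⟩
  rw [Set.mem_neg]
  convert h using 1
  module

/-- The set of pairs of points of `C` together with an upper bound of the sum of the values. -/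
def pairEpi (C : Set V) (φ : V → ℝ) : Set (V × V × ℝ) :=
  {z | z.1 ∈ C ∧ z.2.1 ∈ C ∧ φ z.1 + φ z.2.1 ≤ z.2.2}

omit [NormedSpace ℝ V] in
lemma epi_isClosed_of_pairEpi (hcl : IsClosed (pairEpi C φ)) : IsClosed (epi C φ) := by
  convert hcl.preimage (f := fun z : V × ℝ => (z.1, z.1, 2 * z.2)) (by fun_prop) using 1
  ext z
  simp only [epi, pairEpi, Set.mem_preimage, Set.mem_ofPred_eq]
  refine ⟨fun h => ⟨h.1, h.1, by linarith [h.2]⟩, fun h => ⟨h.1, by linarith [h.2.2]⟩⟩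

end Symmetry

/-- A nonempty convex set in finite dimension has a relative interior point. -/
lemma exists_relInt {V : Type*} [NormedAddCommGroup V] [NormedSpace ℝ V] [FiniteDimensional ℝ V]
    {C : Set V} (hC : Convex ℝ C) (hne : C.Nonempty) : ∃ p, RelInt C p := by
  obtain ⟨p, hp⟩ := hne.intrinsicInterior hC
  refine ⟨p, intrinsicInterior_subset hp, fun v hv => ?_⟩
  obtain ⟨x, hx, rfl⟩ := mem_intrinsicInterior.1 hp
  have hv' : v ∈ affineSpan ℝ C := subset_affineSpan ℝ C hv
  have hmem : ∀ ε : ℝ, (x : V) - ε • (v - x) ∈ affineSpan ℝ C := by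
    intro ε
    have := AffineMap.lineMap_mem (-ε) x.2 hv'
    convert this using 1
    simp [AffineMap.lineMap_apply]; module
  have hcont : Continuous fun ε : ℝ => (⟨(x : V) - ε • (v - x), hmem ε⟩ : affineSpan ℝ C) := by
    refine Continuous.subtype_mk (by fun_prop) _
  have h0 : (fun ε : ℝ => (⟨(x : V) - ε • (v - x), hmem ε⟩ : affineSpan ℝ C)) 0 = x := by
    ext; simp
  have hnhds := hcont.continuousAt.preimage_mem_nhds (x := 0)
    (t := ((↑) : affineSpan ℝ C → V) ⁻¹' C) (by
      change _ ∈ 𝓝 ((fun ε : ℝ => (⟨(x : V) - ε • (v - x), hmem ε⟩ : affineSpan ℝ C)) 0)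
      rw [h0]; exact mem_interior_iff_mem_nhds.1 hx)
  obtain ⟨δ, hδ, hball⟩ := Metric.mem_nhds_iff.1 hnhds
  refine ⟨δ / 2, by positivity, ?_⟩
  exact hball (show δ / 2 ∈ Metric.ball 0 δ by
    rw [Metric.mem_ball, Real.dist_eq, sub_zero, abs_of_pos (by positivity)]; linarith)

/-! ### Exchange of subgradients forces submodularity. -/

section Subgradients

variable {ι : Type*} [Fintype ι]

/-- Subgradients at `p` of a real function on `C`. -/
def Sub (C : Set (ι → ℝ)) (φ : (ι → ℝ) → ℝ) (p : ι → ℝ) : Set (ι → ℝ) :=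
  {x | p ∈ C ∧ ∀ v ∈ C, φ p + x ⬝ᵥ (v - p) ≤ φ v}

/-- Subgradients at comparable points `p ≤ p'` can be exchanged on the coordinates where the
points agree. -/
def SubExch (C : Set (ι → ℝ)) (φ : (ι → ℝ) → ℝ) : Prop :=
  ∀ p p', p ≤ p' → ∀ x ∈ Sub C φ p', ∀ y ∈ Sub C φ p, ∀ δ₁ : ι → ℝ,
    (∀ i, 0 ≤ δ₁ i ∧ δ₁ i ≤ max (x i - y i) 0) →
    ∃ x' ∈ Sub C φ p', ∃ y' ∈ Sub C φ p, ∃ δ₂ : ι → ℝ,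
      (∀ i, 0 ≤ δ₂ i ∧ δ₂ i ≤ max (y i - x i) 0) ∧
      ∀ i, p i = p' i → x' i = x i - (δ₁ i - δ₂ i) ∧ y' i = y i + (δ₁ i - δ₂ i)

variable {C : Set (ι → ℝ)} {φ : (ι → ℝ) → ℝ}

/-- Subgradients exist at relative interior points of box-constrained problems, with the sign
conditions of complementary slackness. -/
lemma exists_sub_of_isMinOn_box (hφ : ConvexOn ℝ C φ) {p : ι → ℝ} (hp : RelInt C p)
    {w : ι → ℝ} (hw : 0 ≤ w) {k : ℝ} {z : ι → ℝ} (hz : z ∈ C) (hzp : z ≤ p) (hpz : p - w ≤ z)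
    (hmin : ∀ v ∈ C, v ≤ p → p - w ≤ v → φ z + k * ∑ i, z i ≤ φ v + k * ∑ i, v i) :
    ∃ q ∈ Sub C φ z, ∀ i, p i - w i < z i → q i ≤ -k := by
  classical
  let L : ι → (ι → ℝ) →ᵃ[ℝ] ℝ := fun i => (LinearMap.proj i : (ι → ℝ) →ₗ[ℝ] ℝ).toAffineMap
  let a : ι ⊕ ι → (ι → ℝ) →ᵃ[ℝ] ℝ := Sum.elim
    (fun i => L i - AffineMap.const ℝ _ (p i)) (fun i => AffineMap.const ℝ _ (p i - w i) - L i)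
  have al : ∀ i v, a (.inl i) v = v i - p i := fun i v => rfl
  have ar : ∀ i v, a (.inr i) v = p i - w i - v i := fun i v => rfl
  have hg : ConvexOn ℝ C (fun v => (φ v + k * ∑ i, v i) + -(φ z + k * ∑ i, z i)) := by
    refine (hφ.add ⟨hφ.1, fun x hx y hy α β hα hβ hαβ => le_of_eq ?_⟩).add_const _
    simp only [Pi.add_apply, Pi.smul_apply, smul_eq_mul, Finset.sum_add_distrib,
      ← Finset.mul_sum]
    ring
  obtain ⟨l, hl, hlC⟩ := exists_multipliers a Finset.univ hp hg
    (by
      rintro (i | i) -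
      · rw [al]; simp
      · rw [ar]; have := hw i; simp only [Pi.zero_apply] at this; linarith)
    (by
      intro v hv hav
      have h1 : v ≤ p := fun i => by have := hav (.inl i) (Finset.mem_univ _); rw [al] at this; linarith
      have h2 : p - w ≤ v := fun i => by
        have := hav (.inr i) (Finset.mem_univ _); rw [ar] at this
        simp only [Pi.sub_apply]; linarith
      have := hmin v hv h1 h2
      linarith)
  have hterm : ∀ j ∈ Finset.univ, l j * a j z ≤ 0 := by
    rintro (i | i) hi
    · exact mul_nonpos_of_nonneg_of_nonpos (hl _ hi) (by rw [al]; linarith [hzp i])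
    · refine mul_nonpos_of_nonneg_of_nonpos (hl _ hi) ?_
      have := hpz i
      simp only [Pi.sub_apply] at this
      rw [ar]; linarith
  have hsum0 : ∑ j, l j * a j z = 0 := by
    refine le_antisymm (Finset.sum_nonpos hterm) ?_
    have := hlC z hz
    linarith
  have hcs := (Finset.sum_eq_zero_iff_of_nonpos hterm).1 hsum0
  -- This is stationarity of the Lagrangian at `z`. Off the lower face the multiplier `l (.inr i)`
  -- vanishes by complementary slackness, leaving at most `-k`.
  refine ⟨fun i => -k - l (.inl i) + l (.inr i), ⟨hz, fun v hv => ?_⟩, fun i hi => ?_⟩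
  · have h1 := hlC v hv
    have h2 : ∑ j, l j * a j v = ∑ j, l j * a j v - ∑ j, l j * a j z := by rw [hsum0, sub_zero]
    rw [h2, ← Finset.sum_sub_distrib, Fintype.sum_sum_type] at h1
    simp only [al, ar] at h1
    have h3 : (fun i => -k - l (.inl i) + l (.inr i)) ⬝ᵥ (v - z)
        = -(k * ∑ i, v i) + k * ∑ i, z i
          - ∑ i, (l (.inl i) * (v i - p i) - l (.inl i) * (z i - p i))
          - ∑ i, (l (.inr i) * (p i - w i - v i) - l (.inr i) * (p i - w i - z i)) := by
      simp only [dotProduct, Finset.mul_sum, ← Finset.sum_neg_distrib, ← Finset.sum_add_distrib,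
        ← Finset.sum_sub_distrib, Pi.sub_apply]
      exact Finset.sum_congr rfl fun i _ => by ring
    rw [h3]
    linarith
  · have h1 := hcs (.inr i) (Finset.mem_univ _)
    rw [ar] at h1
    have h2 : l (.inr i) = 0 := (mul_eq_zero.1 h1).resolve_right (by linarith)
    have h3 := hl (.inl i) (Finset.mem_univ _)
    simp only [h2]
    linarith

/-- The degenerate box `w = 0` contains only `p`, so minimality is trivial and the multipliers form
a subgradient. -/
lemma RelInt.exists_sub (hφ : ConvexOn ℝ C φ) {p : ι → ℝ} (hp : RelInt C p) :
    (Sub C φ p).Nonempty := by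
  obtain ⟨q, hq, -⟩ := exists_sub_of_isMinOn_box hφ hp (w := 0) (k := 0) le_rfl hp.1 le_rfl
    (by simp) (fun v _ h1 h2 => by
      rw [sub_zero] at h2
      rw [le_antisymm h1 h2])
  exact ⟨q, hq⟩

/-- Transfer the whole excess of `x` over `y`; the compensating decrease never takes a coordinate
below `x`. -/
lemma SubExch.exists_ge (h : SubExch C φ) {p p' x y : ι → ℝ} (hpp : p ≤ p')
    (hx : x ∈ Sub C φ p') (hy : y ∈ Sub C φ p) :
    ∃ y' ∈ Sub C φ p, ∀ i, p i = p' i → x i ≤ y' i := by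
  obtain ⟨_, _, y', hy', δ₂, hδ₂, hag⟩ := h p p' hpp x hx y hy (fun i => max (x i - y i) 0)
    (fun i => ⟨le_max_right _ _, le_rfl⟩)
  refine ⟨y', hy', fun i hi => ?_⟩
  rw [(hag i hi).2]
  have := (hδ₂ i).2
  rcases le_total (x i) (y i) with h1 | h1
  · rw [max_eq_left (by linarith)] at this
    rw [max_eq_right (by linarith)]
    linarith
  · rw [max_eq_right (by linarith)] at this
    rw [max_eq_left (by linarith)]
    linarith

/-- Exchange at a single point, with the transfer supported on `S`; off `S` only the compensation
acts, and it lowers `q`. -/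
lemma SubExch.exists_ge_le (h : SubExch C φ) {p y q : ι → ℝ} (hy : y ∈ Sub C φ p)
    (hq : q ∈ Sub C φ p) (S : Set ι) :
    ∃ q' ∈ Sub C φ p, (∀ i ∈ S, y i ≤ q' i) ∧ ∀ i ∉ S, q' i ≤ q i := by
  classical
  obtain ⟨_, _, q', hq', δ₂, hδ₂, hag⟩ := h p p le_rfl y hy q hq
    (fun i => if i ∈ S then max (y i - q i) 0 else 0)
    (fun i => by split_ifs <;> simp)
  refine ⟨q', hq', fun i hi => ?_, fun i hi => ?_⟩
  · rw [(hag i rfl).2, if_pos hi]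
    have := (hδ₂ i).2
    rcases le_total (y i) (q i) with h1 | h1
    · rw [max_eq_left (by linarith)] at this
      rw [max_eq_right (by linarith)]
      linarith
    · rw [max_eq_right (by linarith)] at this
      rw [max_eq_left (by linarith)]
      linarith
  · rw [(hag i rfl).2, if_neg hi]
    have := (hδ₂ i).1
    linarith

/-- Since `φ` need not be continuous, a continuous function is minimised over a compact piece of the
epigraph. The subgradient bounds heights below, and points higher than `R` cannot beat `p`. -/
lemma exists_isMinOn_box (hcl : IsClosed (epi C φ)) {p : ι → ℝ} (hp : p ∈ C)
    (hsub : (Sub C φ p).Nonempty) {w : ι → ℝ} (hw : 0 ≤ w) (k : ℝ) :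
    ∃ z ∈ C, z ≤ p ∧ p - w ≤ z ∧
      ∀ v ∈ C, v ≤ p → p - w ≤ v → φ z + k * ∑ i, z i ≤ φ v + k * ∑ i, v i := by
  obtain ⟨x, -, hx⟩ := hsub
  have hB : IsCompact (Set.Icc (p - w) p) := isCompact_Icc
  obtain ⟨m, hm⟩ := (hB.image (f := fun v => φ p + x ⬝ᵥ (v - p))
    (by simp only [dotProduct]; fun_prop)).bddBelow
  obtain ⟨s, hs⟩ := (hB.image (f := fun v => k * ∑ i, v i) (by fun_prop)).bddBelow
  have hs' : ∀ v ∈ Set.Icc (p - w) p, s ≤ k * ∑ i, v i := fun v hv => hs ⟨v, hv, rfl⟩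
  have hm' : ∀ v ∈ Set.Icc (p - w) p, v ∈ C → m ≤ φ v := fun v hv hvC =>
    (hm ⟨v, hv, rfl⟩).trans (hx v hvC)
  have hpB : p ∈ Set.Icc (p - w) p := ⟨by simpa using hw, le_rfl⟩
  set R := φ p + k * ∑ i, p i - s
  have hpR : φ p ≤ R := by have := hs' p hpB; simp only [R]; linarith
  have hK : IsCompact ((Set.Icc (p - w) p ×ˢ Set.Icc m R) ∩ epi C φ) :=
    (hB.prod isCompact_Icc).inter_right hcl
  obtain ⟨⟨z, r⟩, ⟨⟨hzB, hr⟩, hzC, hzr⟩, hmin⟩ := hK.exists_isMinOn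
    ⟨(p, φ p), ⟨hpB, hm' p hpB hp, hpR⟩, hp, le_rfl⟩
    (f := fun y => y.2 + k * ∑ i, y.1 i) (by fun_prop)
  simp only at hzB hr hzC hzr
  refine ⟨z, hzC, hzB.2, hzB.1, fun v hv h1 h2 => ?_⟩
  have hvB : v ∈ Set.Icc (p - w) p := ⟨h2, h1⟩
  by_cases hvR : φ v ≤ R
  · have := hmin (show (v, φ v) ∈ _ from ⟨⟨hvB, hm' v hvB hv, hvR⟩, hv, le_rfl⟩)
    simp only [Set.mem_ofPred_eq] at this
    linarith
  · have := hmin (show (p, φ p) ∈ _ from ⟨⟨hpB, hm' p hpB hp, hpR⟩, hp, le_rfl⟩)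
    simp only [Set.mem_ofPred_eq] at this
    have := hs' v hvB
    simp only [R] at hvR
    linarith

/-- Moving down from a relative interior point in coordinates disjoint from the increase `d`. -/
lemma SubExch.sub_mem_and_le (h : SubExch C φ) (hφ : ConvexOn ℝ C φ) (hcl : IsClosed (epi C φ))
    {p x d w : ι → ℝ} (hp : RelInt C p) (hx : x ∈ Sub C φ p) (hd : 0 ≤ d) (hw : 0 ≤ w)
    (hdw : ∀ i, d i = 0 ∨ w i = 0) (hmem : p + d - w ∈ C) :
    p - w ∈ C ∧ φ (p - w) + x ⬝ᵥ d ≤ φ (p + d - w) := by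
  have key : ∀ k : ℕ, ∃ z ∈ C, z ≤ p ∧ p - w ≤ z ∧
      φ z + x ⬝ᵥ d + k * ∑ i, (z i - (p i - w i)) ≤ φ (p + d - w) := by
    intro k
    obtain ⟨z, hz, hzp, hpz, hmin⟩ := exists_isMinOn_box hcl hp.1 ⟨x, hx⟩ hw k
    obtain ⟨q, hq, hqk⟩ := exists_sub_of_isMinOn_box hφ hp hw hz hzp hpz hmin
    obtain ⟨y, hy, hyx⟩ := h.exists_ge hzp hx hq
    -- Where `w` vanishes, `z` agrees with `p` and `q'` dominates `x`; elsewhere `d` vanishes and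
    -- `q'` inherits the bound `-k` from `q`.
    obtain ⟨q', hq', hS, hSc⟩ := h.exists_ge_le hy hq {i | w i = 0}
    refine ⟨z, hz, hzp, hpz, le_trans ?_ (hq'.2 _ hmem)⟩
    rw [add_assoc]
    gcongr
    simp only [dotProduct]
    rw [Finset.mul_sum, ← Finset.sum_add_distrib]
    refine Finset.sum_le_sum fun i _ => ?_
    have h1 := hzp i
    have h2 := hpz i
    have h3 := hd i
    simp only [Pi.add_apply, Pi.sub_apply, Pi.zero_apply] at h1 h2 h3 ⊢
    by_cases hwi : w i = 0
    · have h4 : z i = p i := by rw [hwi] at h2; linarith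
      have h5 := hyx i h4
      have h6 := hS i hwi
      rw [h4, hwi]
      nlinarith
    · have h4 : d i = 0 := (hdw i).resolve_right hwi
      have h5 := hSc i hwi
      rw [h4]
      rcases h2.lt_or_eq with h6 | h6
      · have h7 := hqk i h6
        nlinarith
      · rw [← h6]; simp
  choose z hzC hzp hpz hz using key
  set B := φ (p + d - w) - x ⬝ᵥ d with hB
  -- With `φ (z k)` bounded below, the penalty term forces `z k` to `p - w` at rate `1 / k`.
  obtain ⟨m, hm⟩ : ∃ m, ∀ k, m ≤ φ (z k) := by
    obtain ⟨m, hm⟩ := ((isCompact_Icc (a := p - w) (b := p)).image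
      (f := fun v => φ p + x ⬝ᵥ (v - p)) (by simp only [dotProduct]; fun_prop)).bddBelow
    exact ⟨m, fun k => (hm ⟨z k, ⟨hpz k, hzp k⟩, rfl⟩).trans (hx.2 _ (hzC k))⟩
  have hsum : ∀ k i, z k i - (p i - w i) ≤ ∑ i, (z k i - (p i - w i)) := fun k i =>
    Finset.single_le_sum (f := fun i => z k i - (p i - w i))
      (fun i _ => by have := hpz k i; simp only [Pi.sub_apply] at this; linarith)
      (Finset.mem_univ i)
  have hlim : Tendsto z atTop (𝓝 (p - w)) := by
    rw [tendsto_pi_nhds]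
    intro i
    have hup : ∀ᶠ k : ℕ in atTop, z k i ≤ (p i - w i) + (B - m) / k := by
      filter_upwards [eventually_gt_atTop 0] with k hk
      have hk' : (0 : ℝ) < k := by exact_mod_cast hk
      rw [← sub_le_iff_le_add', le_div_iff₀ hk']
      have h1 := hz k
      have h2 := hm k
      have h3 := hsum k i
      nlinarith
    have hl2 : Tendsto (fun k : ℕ => (p i - w i) + (B - m) / k) atTop (𝓝 ((p i - w i) + 0)) :=
      tendsto_const_nhds.add (tendsto_const_div_atTop_nhds_zero_nat _)
    rw [add_zero] at hl2
    exact tendsto_of_tendsto_of_tendsto_of_le_of_le' tendsto_const_nhds hl2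
      (Eventually.of_forall fun k => hpz k i) hup
  have hmemB : (p - w, B) ∈ epi C φ := by
    refine hcl.mem_of_tendsto (hlim.prodMk_nhds tendsto_const_nhds)
      (Eventually.of_forall fun k => ⟨hzC k, ?_⟩)
    have h1 := hz k
    have h2 : 0 ≤ (k : ℝ) * ∑ i, (z k i - (p i - w i)) :=
      mul_nonneg k.cast_nonneg (Finset.sum_nonneg fun i _ => by
        have := hpz k i; simp only [Pi.sub_apply] at this; linarith)
    simp only [hB]
    linarith
  refine ⟨hmemB.1, ?_⟩
  have := hmemB.2
  simp only [hB] at this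
  linarith

lemma mem_sub_neg {p x : ι → ℝ} :
    x ∈ Sub (-C) (fun v => φ (-v)) p ↔ -x ∈ Sub C φ (-p) := by
  refine and_congr Iff.rfl ⟨fun h v hv => ?_, fun h v hv => ?_⟩
  · have := h (-v) (by simpa using hv)
    simp only [neg_neg] at this
    convert this using 2
    rw [neg_dotProduct, ← dotProduct_neg]
    congr 1; abel
  · have := h (-v) hv
    convert this using 2
    rw [neg_dotProduct, ← dotProduct_neg]
    congr 1; abel

/-- Reflection reverses both the order of the points and the sign of the subgradients, so the
hypothesis is self-dual with the two roles swapped. -/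
lemma SubExch.neg (h : SubExch C φ) : SubExch (-C) (fun v => φ (-v)) := by
  intro p p' hpp x hx y hy δ₁ hδ₁
  rw [mem_sub_neg] at hx hy
  obtain ⟨y', hy', x', hx', δ₂, hδ₂, hag⟩ := h (-p') (-p) (neg_le_neg hpp) (-y) hy (-x) hx δ₁
    (fun i => by
      have := hδ₁ i
      simpa [neg_add_eq_sub] using this)
  refine ⟨-x', ?_, -y', ?_, δ₂, fun i => ?_, fun i hi => ?_⟩
  · rw [mem_sub_neg, neg_neg]; exact hx'
  · rw [mem_sub_neg, neg_neg]; exact hy'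
  · have := hδ₂ i
    simpa [neg_add_eq_sub] using this
  · obtain ⟨h1, h2⟩ := hag i (by simp [hi])
    simp only [Pi.neg_apply] at h1 h2 ⊢
    constructor <;> linarith

/-- Moving up from a relative interior point in coordinates disjoint from the decrease `w`. -/
lemma SubExch.add_mem (h : SubExch C φ) (hφ : ConvexOn ℝ C φ) (hcl : IsClosed (epi C φ))
    {p d w : ι → ℝ} (hp : RelInt C p) (hd : 0 ≤ d) (hw : 0 ≤ w)
    (hdw : ∀ i, d i = 0 ∨ w i = 0) (hmem : p + d - w ∈ C) : p + d ∈ C := by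
  obtain ⟨x, hx⟩ := hp.neg.exists_sub (convexOn_neg hφ)
  have := (h.neg.sub_mem_and_le (convexOn_neg hφ) (epi_neg_isClosed hcl) hp.neg hx hw hd
    (fun i => (hdw i).symm) (by
      rw [Set.mem_neg]; convert hmem using 1; abel)).1
  rw [Set.mem_neg] at this
  convert this using 1; abel

/-- A subgradient at a point of the path from `p` to `p + d` bounds the preceding increment of `φ`
above and the following increment of `φ (· - w)` below. Telescoping leaves an index shift of one,
which disappears as the mesh tends to zero. -/
lemma SubExch.submodular_of_relInt (h : SubExch C φ) (hφ : ConvexOn ℝ C φ)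
    (hcl : IsClosed (pairEpi C φ)) {p d w : ι → ℝ} (hp : RelInt C p) (hd : 0 ≤ d) (hw : 0 ≤ w)
    (hdw : ∀ i, d i = 0 ∨ w i = 0) (hmem : p + d - w ∈ C) :
    p - w ∈ C ∧ p + d ∈ C ∧ φ (p - w) + φ (p + d) ≤ φ p + φ (p + d - w) := by
  have hcl' := epi_isClosed_of_pairEpi hcl
  have hup := h.add_mem hφ hcl' hp hd hw hdw hmem
  have hdown : p - w ∈ C := by
    obtain ⟨x, hx⟩ := hp.exists_sub hφ
    exact (h.sub_mem_and_le hφ hcl' hp hx hd hw hdw hmem).1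
  have key : ∀ N : ℕ, (p + (1 / ((N : ℝ) + 1)) • d - w,
      p + (1 - 1 / ((N : ℝ) + 1)) • d, φ p + φ (p + d - w)) ∈ pairEpi C φ := by
    intro N
    set s : ℝ := 1 / ((N : ℝ) + 1) with hs
    have hN : (0 : ℝ) < N + 1 := by positivity
    have hspos : 0 < s := by positivity
    have hsN : (N + 1) * s = 1 := by rw [hs]; field_simp
    -- The path stops one step short of `p + d`, which may lack a subgradient.
    have hRI : ∀ k : ℕ, k ≤ N → RelInt C (p + (k * s) • d) := by
      intro k hk
      have hk' : (k : ℝ) ≤ N := by exact_mod_cast hk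
      have := hp.combo hφ.1 hup (t := 1 - k * s) (by nlinarith) (by
        have : 0 ≤ k * s := by positivity
        linarith)
      convert this using 1
      module
    have hlow : ∀ k : ℕ, k ≤ N + 1 → p + (k * s) • d - w ∈ C := by
      intro k hk
      have hk' : (k : ℝ) ≤ N + 1 := by exact_mod_cast hk
      have := hφ.1.add_smul_sub_mem hdown hmem (t := k * s) ⟨by positivity, by nlinarith⟩
      convert this using 1
      module
    have hind : ∀ k : ℕ, k ≤ N →
        φ (p + ((1 : ℕ) * s) • d - w) + φ (p + (k * s) • d)
          ≤ φ p + φ (p + ((k + 1 : ℕ) * s) • d - w) := by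
      intro k
      induction k with
      | zero => intro _; simp [add_comm]
      | succ k ih =>
        intro hk
        have h1 := ih (by omega)
        obtain ⟨x, hx⟩ := (hRI (k + 1) hk).exists_sub hφ
        have e : p + ((k + 1 : ℕ) * s) • d + s • d - w = p + ((k + 1 + 1 : ℕ) * s) • d - w := by
          push_cast; module
        have h2 := (h.sub_mem_and_le hφ hcl' (hRI (k + 1) hk) hx (smul_nonneg hspos.le hd) hw
          (fun i => (hdw i).imp_left fun h0 => by simp [h0])
          (by rw [e]; exact hlow _ (by omega))).2
        rw [e] at h2
        have h3 := hx.2 _ (hRI k (by omega)).1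
        have e' : p + (k * s) • d - (p + ((k + 1 : ℕ) * s) • d) = -(s • d) := by
          push_cast; module
        rw [e', dotProduct_neg] at h3
        linarith
    have h1 := hlow 1 (by omega)
    have h2 := (hRI N le_rfl).1
    have h3 := hind N le_rfl
    have e1 : ((1 : ℕ) * s) = s := by simp
    have e2 : (N : ℝ) * s = 1 - s := by linarith
    have e3 : ((N + 1 : ℕ) : ℝ) * s = 1 := by push_cast; exact hsN
    rw [e1] at h1 h3
    rw [e2] at h2 h3
    rw [e3, one_smul] at h3
    exact ⟨h1, h2, h3⟩
  have hl := tendsto_one_div_add_atTop_nhds_zero_nat (𝕜 := ℝ)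
  have hT : Tendsto (fun N : ℕ => (p + (1 / ((N : ℝ) + 1)) • d - w,
      p + (1 - 1 / ((N : ℝ) + 1)) • d, φ p + φ (p + d - w))) atTop
      (𝓝 (p + (0 : ℝ) • d - w, p + (1 - 0 : ℝ) • d, φ p + φ (p + d - w))) :=
    ((tendsto_const_nhds.add (hl.smul_const d)).sub_const w).prodMk_nhds
      ((tendsto_const_nhds.add ((tendsto_const_nhds.sub hl).smul_const d)).prodMk_nhds
        tendsto_const_nhds)
  have := hcl.mem_of_tendsto hT (Eventually.of_forall key)
  simpa [pairEpi] using this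

/-- Exchange of subgradients implies submodularity. -/
theorem SubExch.submodular (h : SubExch C φ) (hφ : ConvexOn ℝ C φ)
    (hcl : IsClosed (pairEpi C φ)) {p p' : ι → ℝ} (hp : p ∈ C) (hp' : p' ∈ C) :
    p ⊓ p' ∈ C ∧ p ⊔ p' ∈ C ∧ φ (p ⊓ p') + φ (p ⊔ p') ≤ φ p + φ p' := by
  obtain ⟨o, ho⟩ := exists_relInt hφ.1 ⟨p, hp⟩
  -- Both points are moved slightly towards `o`, making the first relatively interior; convexity
  -- controls the values on the right-hand side in the limit.
  have key : ∀ N : ℕ, ((p + (1 / ((N : ℝ) + 1)) • (o - p)) ⊓ (p' + (1 / ((N : ℝ) + 1)) • (o - p')),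
      (p + (1 / ((N : ℝ) + 1)) • (o - p)) ⊔ (p' + (1 / ((N : ℝ) + 1)) • (o - p')),
      (φ p + (1 / ((N : ℝ) + 1)) * (φ o - φ p)) + (φ p' + (1 / ((N : ℝ) + 1)) * (φ o - φ p')))
      ∈ pairEpi C φ := by
    intro N
    set s : ℝ := 1 / ((N : ℝ) + 1) with hs
    have hspos : 0 < s := by positivity
    have hs1 : s ≤ 1 := by
      rw [hs, div_le_one (by positivity)]
      linarith [N.cast_nonneg (α := ℝ)]
    have hval : ∀ v ∈ C, φ (v + s • (o - v)) ≤ φ v + s * (φ o - φ v) := by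
      intro v hv
      have := hφ.2 hv ho.1 (sub_nonneg.2 hs1) hspos.le (by ring)
      simp only [smul_eq_mul] at this
      have e : v + s • (o - v) = (1 - s) • v + s • o := by module
      rw [e]; linarith
    have ha := ho.combo hφ.1 hp hspos hs1
    have hb := (ho.combo hφ.1 hp' hspos hs1).1
    have hav := hval p hp
    have hbv := hval p' hp'
    set a := p + s • (o - p)
    set b := p' + s • (o - p')
    have e1 : a + (fun i => max (b i - a i) 0) = a ⊔ b := by
      ext i
      simp only [Pi.add_apply, Pi.sup_apply]
      rcases le_total (a i) (b i) with h1 | h1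
      · rw [max_eq_left (by linarith), sup_eq_right.2 h1]; ring
      · rw [max_eq_right (by linarith), sup_eq_left.2 h1]; ring
    have e2 : a - (fun i => max (a i - b i) 0) = a ⊓ b := by
      ext i
      simp only [Pi.sub_apply, Pi.inf_apply]
      rcases le_total (a i) (b i) with h1 | h1
      · rw [max_eq_right (by linarith), inf_eq_left.2 h1]; ring
      · rw [max_eq_left (by linarith), inf_eq_right.2 h1]; ring
    have e3 : a + (fun i => max (b i - a i) 0) - (fun i => max (a i - b i) 0) = b := by
      ext i
      simp only [Pi.sub_apply, Pi.add_apply]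
      rcases le_total (a i) (b i) with h1 | h1
      · rw [max_eq_left (by linarith), max_eq_right (by linarith)]; ring
      · rw [max_eq_right (by linarith), max_eq_left (by linarith)]; ring
    have := h.submodular_of_relInt hφ hcl ha (d := fun i => max (b i - a i) 0)
      (w := fun i => max (a i - b i) 0) (fun i => le_max_right _ _) (fun i => le_max_right _ _)
      (fun i => by
        rcases le_total (a i) (b i) with h1 | h1
        · exact Or.inr (max_eq_right (by linarith))
        · exact Or.inl (max_eq_right (by linarith)))
      (by rw [e3]; exact hb)
    rw [e3, e2, e1] at this
    exact ⟨this.1, this.2.1, by simp only; linarith [this.2.2]⟩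
  have hl := tendsto_one_div_add_atTop_nhds_zero_nat (𝕜 := ℝ)
  have hcont : Continuous fun s : ℝ => ((p + s • (o - p)) ⊓ (p' + s • (o - p')),
      (p + s • (o - p)) ⊔ (p' + s • (o - p')),
      (φ p + s * (φ o - φ p)) + (φ p' + s * (φ o - φ p'))) := by
    refine Continuous.prodMk ?_ (Continuous.prodMk ?_ (by fun_prop))
    · exact continuous_pi fun i => Continuous.inf (by fun_prop) (by fun_prop)
    · exact continuous_pi fun i => Continuous.sup (by fun_prop) (by fun_prop)
  have := hcl.mem_of_tendsto ((hcont.tendsto 0).comp hl) (Eventually.of_forall key)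
  simpa [pairEpi] using this

end Subgradients

/-! ### Passing from extended-real to real values. -/

section Extended

variable {ι : Type*} {f : (ι → ℝ) → EReal}

lemma coe_toReal_of_mem (hb : ∀ x, f x ≠ ⊥) {x : ι → ℝ} (hx : x ∈ effDom f) :
    ((f x).toReal : EReal) = f x :=
  EReal.coe_toReal (ne_of_lt hx) (hb x)

lemma mem_effDom_of_le_coe {x : ι → ℝ} {r : ℝ} (h : f x ≤ r) : x ∈ effDom f :=
  h.trans_lt (EReal.coe_lt_top r)

lemma le_coe_iff (hb : ∀ x, f x ≠ ⊥) {x : ι → ℝ} {r : ℝ} :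
    f x ≤ r ↔ x ∈ effDom f ∧ (f x).toReal ≤ r := by
  refine ⟨fun h => ⟨mem_effDom_of_le_coe h, ?_⟩, fun h => ?_⟩
  · rw [← coe_toReal_of_mem hb (mem_effDom_of_le_coe h)] at h
    exact EReal.coe_le_coe_iff.1 h
  · rw [← coe_toReal_of_mem hb h.1]
    exact EReal.coe_le_coe_iff.2 h.2

lemma add_le_coe_iff (hb : ∀ x, f x ≠ ⊥) {x y : ι → ℝ} {r : ℝ} :
    f x + f y ≤ r ↔ x ∈ effDom f ∧ y ∈ effDom f ∧ (f x).toReal + (f y).toReal ≤ r := by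
  by_cases hx : x ∈ effDom f
  · by_cases hy : y ∈ effDom f
    · rw [← coe_toReal_of_mem hb hx, ← coe_toReal_of_mem hb hy, ← EReal.coe_add,
        EReal.coe_le_coe_iff]
      simp [hx, hy]
    · have : f y = ⊤ := not_lt_top_iff.1 hy
      rw [this, EReal.add_top_of_ne_bot (hb x)]
      simp [hy]
  · have : f x = ⊤ := not_lt_top_iff.1 hx
    rw [this, EReal.top_add_of_ne_bot (hb y)]
    simp [hx]

lemma convexOn_toReal (hb : ∀ x, f x ≠ ⊥) (hf : IsConvex f) :
    ConvexOn ℝ (effDom f) (fun x => (f x).toReal) := by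
  rw [convexOn_iff_convex_epigraph]
  have : {z : (ι → ℝ) × ℝ | z.1 ∈ effDom f ∧ (f z.1).toReal ≤ z.2}
      = {z : (ι → ℝ) × ℝ | f z.1 ≤ (z.2 : EReal)} :=
    Set.ext fun z => (le_coe_iff hb).symm
  rw [this]
  exact hf

lemma pairEpi_isClosed [Fintype ι] (hb : ∀ x, f x ≠ ⊥) (hf : LowerSemicontinuous f) :
    IsClosed (pairEpi (effDom f) (fun x => (f x).toReal)) := by
  have h : LowerSemicontinuous fun z : (ι → ℝ) × (ι → ℝ) => f z.1 + f z.2 :=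
    (hf.comp continuous_fst).add' (hf.comp continuous_snd) fun z =>
      EReal.continuousAt_add (Or.inr (hb _)) (Or.inl (hb _))
  have h' := h.isClosed_epigraph.preimage
    (f := fun z : (ι → ℝ) × (ι → ℝ) × ℝ => ((z.1, z.2.1), (z.2.2 : EReal)))
    ((by fun_prop : Continuous fun z : (ι → ℝ) × (ι → ℝ) × ℝ => (z.1, z.2.1)).prodMk
      (continuous_coe_real_ereal.comp (by fun_prop)))
  convert h' using 1
  ext z
  exact (add_le_coe_iff hb).symm

lemma isSubmodular_iff (hb : ∀ x, f x ≠ ⊥) :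
    IsSubmodular f ↔ ∀ x ∈ effDom f, ∀ y ∈ effDom f, x ⊓ y ∈ effDom f ∧ x ⊔ y ∈ effDom f ∧
      (f (x ⊓ y)).toReal + (f (x ⊔ y)).toReal ≤ (f x).toReal + (f y).toReal := by
  refine forall₄_congr fun x hx y hy => ?_
  rw [← add_le_coe_iff hb, EReal.coe_add, coe_toReal_of_mem hb hx, coe_toReal_of_mem hb hy]

lemma isExchangeable_iff (hb : ∀ x, f x ≠ ⊥) :
    IsExchangeable f ↔ ∀ x ∈ effDom f, ∀ y ∈ effDom f, ∀ δ₁ ∈ Set.Icc 0 (x - y)⁺,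
      ∃ δ₂ ∈ Set.Icc 0 (x - y)⁻, x - (δ₁ - δ₂) ∈ effDom f ∧ y + (δ₁ - δ₂) ∈ effDom f ∧
        (f (x - (δ₁ - δ₂))).toReal + (f (y + (δ₁ - δ₂))).toReal
          ≤ (f x).toReal + (f y).toReal := by
  refine forall₄_congr fun x hx y hy => forall₂_congr fun δ₁ _ => exists_congr fun δ₂ =>
    and_congr_right fun _ => ?_
  rw [← add_le_coe_iff hb, EReal.coe_add, coe_toReal_of_mem hb hx, coe_toReal_of_mem hb hy]

end Extended

/-! ### Conjugation, subdifferentials and demand. -/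

section Conjugate

variable {ι : Type*} [Fintype ι] {f : (ι → ℝ) → EReal}

lemma conj_le_coe_iff (hb : ∀ x, f x ≠ ⊥) {p : ι → ℝ} {r : ℝ} :
    conj f p ≤ r ↔ ∀ q ∈ effDom f, p ⬝ᵥ q - (f q).toReal ≤ r := by
  rw [conj, iSup_le_iff]
  refine forall_congr' fun q => ?_
  by_cases hq : q ∈ effDom f
  · rw [← coe_toReal_of_mem hb hq, ← EReal.coe_sub, EReal.coe_le_coe_iff]
    simp [hq]
  · have : f q = ⊤ := not_lt_top_iff.1 hq
    simp [this, hq]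

lemma conj_ne_bot (hf : IsProper f) (p : ι → ℝ) : conj f p ≠ ⊥ := by
  obtain ⟨q, hq⟩ := hf.2
  have h : (p ⬝ᵥ q : ℝ) - f q ≤ conj f p := le_iSup (fun q => ((p ⬝ᵥ q : ℝ) : EReal) - f q) q
  rw [← coe_toReal_of_mem hf.1 hq, ← EReal.coe_sub] at h
  exact ne_bot_of_le_ne_bot (EReal.coe_ne_bot _) h

lemma fenchel_young (hf : IsProper f) {p q : ι → ℝ} (hp : p ∈ effDom (conj f))
    (hq : q ∈ effDom f) : p ⬝ᵥ q - (f q).toReal ≤ (conj f p).toReal :=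
  (conj_le_coe_iff hf.1).1 (coe_toReal_of_mem (conj_ne_bot hf) hp).ge q hq

lemma conj_toReal_le (hf : IsProper f) {p : ι → ℝ} {r : ℝ}
    (h : ∀ q ∈ effDom f, p ⬝ᵥ q - (f q).toReal ≤ r) :
    p ∈ effDom (conj f) ∧ (conj f p).toReal ≤ r :=
  (le_coe_iff (conj_ne_bot hf)).1 ((conj_le_coe_iff hf.1).2 h)

lemma conj_isConvex (hb : ∀ x, f x ≠ ⊥) : IsConvex (conj f) := by
  intro x hx y hy α β hα hβ hαβ
  simp only [Set.mem_ofPred_eq, conj_le_coe_iff hb] at hx hy ⊢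
  intro q hq
  have h1 := mul_le_mul_of_nonneg_left (hx q hq) hα
  have h2 := mul_le_mul_of_nonneg_left (hy q hq) hβ
  simp only [Prod.fst_add, Prod.smul_fst, Prod.snd_add, Prod.smul_snd, add_dotProduct,
    smul_dotProduct, smul_eq_mul]
  have : (f q).toReal = α * (f q).toReal + β * (f q).toReal := by rw [← add_mul, hαβ, one_mul]
  linarith

lemma conj_lowerSemicontinuous (hb : ∀ x, f x ≠ ⊥) : LowerSemicontinuous (conj f) := by
  refine lowerSemicontinuous_iSup fun q => ?_
  by_cases hq : q ∈ effDom f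
  · rw [← coe_toReal_of_mem hb hq]
    simp only [← EReal.coe_sub]
    refine (continuous_coe_real_ereal.comp ?_).lowerSemicontinuous
    simp only [dotProduct]
    fun_prop
  · have : f q = ⊤ := not_lt_top_iff.1 hq
    simp only [this, EReal.sub_top]
    exact lowerSemicontinuous_const

lemma mem_subdiff_iff (hf : IsProper f) {p q : ι → ℝ} :
    q ∈ subdiff f p ↔ q ∈ Sub (effDom f) (fun x => (f x).toReal) p := by
  have hb := conj_ne_bot hf q
  by_cases hp : p ∈ effDom f
  · have hge : ((q ⬝ᵥ p : ℝ) : EReal) - f p ≤ conj f q :=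
      le_iSup (fun v => ((q ⬝ᵥ v : ℝ) : EReal) - f v) p
    have h1 : q ∈ subdiff f p ↔ conj f q ≤ ((q ⬝ᵥ p - (f p).toReal : ℝ) : EReal) := by
      simp only [subdiff, Set.mem_ofPred_eq]
      rw [← coe_toReal_of_mem hf.1 hp] at hge ⊢
      rw [← EReal.coe_sub] at hge
      constructor
      · intro h
        by_cases ht : conj f q = ⊤
        · rw [ht] at h; simp at h
        · rw [← EReal.coe_toReal ht hb] at h ⊢
          norm_cast at h ⊢
          simp only [EReal.toReal_coe]
          linarith
      · intro h
        rw [le_antisymm h hge]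
        norm_cast
        simp
    rw [h1, conj_le_coe_iff hf.1]
    simp only [Sub, Set.mem_ofPred_eq, hp, true_and, dotProduct_sub]
    exact forall₂_congr fun v _ => ⟨fun h => by linarith, fun h => by linarith⟩
  · have ht : f p = ⊤ := not_lt_top_iff.1 hp
    simp [subdiff, Sub, hp, ht, EReal.add_top_of_ne_bot hb]

lemma exists_dotProduct_eq (l : (ι → ℝ) →L[ℝ] ℝ) : ∃ p : ι → ℝ, ∀ x, l x = p ⬝ᵥ x := by
  classical
  refine ⟨fun i => l (Pi.single i 1), fun x => ?_⟩
  have := LinearMap.pi_apply_eq_sum_univ (l : (ι → ℝ) →ₗ[ℝ] ℝ) x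
  simp only [ContinuousLinearMap.coe_coe, smul_eq_mul] at this
  rw [this, dotProduct]
  refine Finset.sum_congr rfl fun i _ => ?_
  rw [mul_comm]
  congr 2
  ext j
  simp [Pi.single_apply, eq_comm]

lemma epi_toReal_isClosed (hb : ∀ x, f x ≠ ⊥) (hl : LowerSemicontinuous f) :
    IsClosed (epi (effDom f) (fun x => (f x).toReal)) :=
  epi_isClosed_of_pairEpi (pairEpi_isClosed hb hl)

/-- The slope of any affine minorant of `f` is a point where the conjugate is finite. -/
lemma conj_isProper (hf : IsProper f) (hc : IsConvex f) (hl : LowerSemicontinuous f) :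
    IsProper (conj f) := by
  refine ⟨conj_ne_bot hf, ?_⟩
  obtain ⟨l, b, h⟩ := exists_affine_le (convexOn_toReal hf.1 hc)
    (epi_toReal_isClosed hf.1 hl) hf.2
  obtain ⟨p, hp⟩ := exists_dotProduct_eq l
  refine ⟨p, (conj_toReal_le hf (r := b) fun q hq => ?_).1⟩
  have := h q hq
  rw [hp] at this
  linarith

/-- By biconjugation, subgradients of the conjugate at `p` are the maximizers of `pᵀq - f(q)`. -/
lemma mem_subdiff_conj_iff (hf : IsProper f) (hc : IsConvex f) (hl : LowerSemicontinuous f)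
    {p q : ι → ℝ} :
    q ∈ subdiff (conj f) p ↔
      q ∈ effDom f ∧ ∀ v ∈ effDom f, p ⬝ᵥ v - (f v).toReal ≤ p ⬝ᵥ q - (f q).toReal := by
  rw [mem_subdiff_iff (conj_isProper hf hc hl)]
  constructor
  · rintro ⟨hp, h⟩
    have key : q ∈ effDom f ∧ (f q).toReal ≤ p ⬝ᵥ q - (conj f p).toReal := by
      -- Otherwise some affine minorant of `f` exceeds the claimed bound at `q`; its slope `v`
      -- violates the subgradient inequality for the conjugate.
      by_contra hcon
      obtain ⟨l, b, hle, hlt⟩ := exists_affine_le_and_lt (convexOn_toReal hf.1 hc)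
        (epi_toReal_isClosed hf.1 hl) hf.2 (isCompact_singleton (x := q)) (convex_singleton q)
        (M := p ⬝ᵥ q - (conj f p).toReal) (by
          rintro k rfl hk
          by_contra! hle
          exact hcon ⟨hk, hle⟩)
      obtain ⟨v, hv⟩ := exists_dotProduct_eq l
      obtain ⟨hvD, hvb⟩ := conj_toReal_le hf (p := v) (r := b) fun a ha => by
        have := hle a ha
        rw [hv] at this
        linarith
      have h1 := h v hvD
      have h2 := hlt q rfl
      rw [hv] at h2
      rw [dotProduct_sub, dotProduct_comm q v, dotProduct_comm q p] at h1
      linarith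
    refine ⟨key.1, fun v hv => ?_⟩
    have := fenchel_young hf hp hv
    linarith [key.2]
  · rintro ⟨hq, h⟩
    obtain ⟨hp, hle⟩ := conj_toReal_le hf h
    refine ⟨hp, fun v hv => ?_⟩
    have := fenchel_young hf hv hq
    rw [dotProduct_sub, dotProduct_comm q v, dotProduct_comm q p]
    linarith

lemma mem_demand_iff (hb : ∀ x, f x ≠ ⊥) {p b q : ι → ℝ} :
    q ∈ demand f p b ↔ q ≤ b ∧ q ∈ effDom f ∧
      ∀ v ∈ effDom f, v ≤ b → p ⬝ᵥ v - (f v).toReal ≤ p ⬝ᵥ q - (f q).toReal := by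
  refine and_congr_right fun _ => and_congr_right fun hq => forall_congr' fun v => ?_
  rw [← coe_toReal_of_mem hb hq, ← EReal.coe_sub]
  by_cases hv : v ∈ effDom f
  · rw [← coe_toReal_of_mem hb hv, ← EReal.coe_sub, EReal.coe_le_coe_iff]
    simp [hv]
  · have : f v = ⊤ := not_lt_top_iff.1 hv
    simp [this, hv]

end Conjugate

/-! ### The implications between the four assertions. -/

section Equivalence

variable {ι : Type*} [Fintype ι] {c : (ι → ℝ) → EReal}

/-- Exchange keeps the total surplus when `δ₁` is supported where the prices agree. -/
lemma IsExchangeable.exists_surplus_le (h : IsExchangeable c) (hb : ∀ x, c x ≠ ⊥)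
    {p p' x y δ₁ : ι → ℝ} (hpp : p ≤ p') (hx : x ∈ effDom c) (hy : y ∈ effDom c)
    (hδ₁ : δ₁ ∈ Set.Icc 0 (x - y)⁺) (hsupp : ∀ i, p i ≠ p' i → δ₁ i = 0) :
    ∃ δ₂ ∈ Set.Icc 0 (x - y)⁻, x - (δ₁ - δ₂) ∈ effDom c ∧ y + (δ₁ - δ₂) ∈ effDom c ∧
      (p' ⬝ᵥ x - (c x).toReal) + (p ⬝ᵥ y - (c y).toReal)
        ≤ (p' ⬝ᵥ (x - (δ₁ - δ₂)) - (c (x - (δ₁ - δ₂))).toReal)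
          + (p ⬝ᵥ (y + (δ₁ - δ₂)) - (c (y + (δ₁ - δ₂))).toReal) := by
  obtain ⟨δ₂, hδ₂, h1, h2, h3⟩ := (isExchangeable_iff hb).1 h x hx y hy δ₁ hδ₁
  refine ⟨δ₂, hδ₂, h1, h2, ?_⟩
  have h4 : 0 ≤ (p' - p) ⬝ᵥ (δ₂ - δ₁) := by
    refine Finset.sum_nonneg fun i _ => ?_
    have h5 := hpp i
    have h6 := hδ₂.1 i
    simp only [Pi.sub_apply, Pi.zero_apply] at *
    by_cases hi : p i = p' i
    · simp [hi]
    · rw [hsupp i hi, sub_zero]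
      exact mul_nonneg (by linarith) h6
  simp only [sub_dotProduct, dotProduct_sub, dotProduct_add] at h4 ⊢
  linarith

/-- Extension by zero of a vector indexed by a set of coordinates. -/
noncomputable def extendZero (I : Set ι) (δ : I → ℝ) (i : ι) : ℝ :=
  open scoped Classical in if h : i ∈ I then δ ⟨i, h⟩ else 0

omit [Fintype ι] in
lemma extendZero_apply {I : Set ι} {δ : I → ℝ} (i : I) : extendZero I δ i = δ i := by
  simp [extendZero]

omit [Fintype ι] in
lemma extendZero_of_notMem {I : Set ι} {δ : I → ℝ} {i : ι} (h : i ∉ I) :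
    extendZero I δ i = 0 := by
  simp [extendZero, h]

omit [Fintype ι] in
lemma extendZero_mem_Icc {I : Set ι} {δ u : I → ℝ} {v : ι → ℝ} (hδ : δ ∈ Set.Icc 0 u)
    (h : ∀ i : I, u i ≤ v i) (hv : 0 ≤ v) : extendZero I δ ∈ Set.Icc 0 v := by
  constructor <;> intro i <;> by_cases hi : i ∈ I
  · rw [extendZero_apply ⟨i, hi⟩]; exact hδ.1 _
  · rw [extendZero_of_notMem hi]; rfl
  · rw [extendZero_apply ⟨i, hi⟩]; exact (hδ.2 _).trans (h ⟨i, hi⟩)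
  · rw [extendZero_of_notMem hi]; exact hv i

/-- Exchange is applied to the demands `q'`, `q`. Both new bundles are feasible and their total
surplus is no smaller, so each must be optimal. -/
lemma IsExchangeable.rejected_setQLE (h : IsExchangeable c) (hp : IsProper c)
    {p p' b b' : ι → ℝ} (hpp : p ≤ p') (hbb : b ≤ b') :
    SetQLE (proj (agree p p') (rejected c p b)) (proj (agree p p') (rejected c p' b')) := by
  rintro _ ⟨_, ⟨q, hq, rfl⟩, rfl⟩ _ ⟨_, ⟨q', hq', rfl⟩, rfl⟩ δ₁ hδ₁
  rw [mem_demand_iff hp.1] at hq hq'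
  obtain ⟨hqb, hqC, hqmax⟩ := hq
  obtain ⟨hqb', hqC', hqmax'⟩ := hq'
  have hδ₁i : ∀ i : agree p p', 0 ≤ δ₁ i ∧ δ₁ i ≤ max (b i - q i - (b' i - q' i)) 0 :=
    fun i => ⟨hδ₁.1 i, hδ₁.2 i⟩
  obtain ⟨δ₂, hδ₂, hx', hy', hle⟩ := h.exists_surplus_le hp.1 hpp hqC' hqC
    (δ₁ := extendZero _ δ₁) (extendZero_mem_Icc hδ₁ (fun i => by
      have := hbb i
      exact max_le_max (by simp only [Pi.sub_apply]; linarith) le_rfl) (posPart_nonneg _))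
    (fun i hi => extendZero_of_notMem hi)
  have hδ₂i : ∀ i, 0 ≤ δ₂ i ∧ δ₂ i ≤ max (-(q' i - q i)) 0 := fun i => ⟨hδ₂.1 i, hδ₂.2 i⟩
  have hfx : q' - (extendZero _ δ₁ - δ₂) ≤ b' := fun i => by
    have h1 : 0 ≤ extendZero _ δ₁ i := by
      by_cases hi : i ∈ agree p p'
      · rw [extendZero_apply ⟨i, hi⟩]; exact (hδ₁i _).1
      · rw [extendZero_of_notMem hi]
    have h2 := (hδ₂i i).2
    have h3 := hqb i
    have h4 := hqb' i
    have h5 := hbb i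
    simp only [Pi.sub_apply]
    rcases max_choice (-(q' i - q i)) 0 with h6 | h6 <;> rw [h6] at h2 <;> linarith
  -- The transfer is bounded by a difference of rejections, hence by the unused capacity `b - q`.
  have hfy : q + (extendZero _ δ₁ - δ₂) ≤ b := fun i => by
    have h1 : extendZero _ δ₁ i ≤ b i - q i := by
      by_cases hi : i ∈ agree p p'
      · rw [extendZero_apply ⟨i, hi⟩]
        have h4 := hqb' i
        exact (hδ₁i ⟨i, hi⟩).2.trans (max_le (by simp only; linarith) (by linarith [hqb i]))
      · rw [extendZero_of_notMem hi]; linarith [hqb i]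
    have h2 := (hδ₂i i).1
    simp only [Pi.add_apply, Pi.sub_apply]
    linarith
  have h1 := hqmax' _ hx' hfx
  have h2 := hqmax _ hy' hfy
  refine ⟨fun i => δ₂ i, ⟨fun i => hδ₂.1 i, fun i => (hδ₂.2 i).trans ?_⟩,
    ⟨_, ⟨q + (extendZero _ δ₁ - δ₂), ?_, rfl⟩, ?_⟩,
    ⟨_, ⟨q' - (extendZero _ δ₁ - δ₂), ?_, rfl⟩, ?_⟩⟩
  · have := hbb i
    exact max_le_max (by simp only [Pi.neg_apply, Pi.sub_apply]; linarith) le_rfl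
  · exact (mem_demand_iff hp.1).2
      ⟨hfy, hy', fun v hv hvb => (hqmax v hv hvb).trans (by linarith)⟩
  · ext i
    simp only [Pi.sub_apply, Pi.add_apply, extendZero_apply]
    ring
  · exact (mem_demand_iff hp.1).2
      ⟨hfx, hx', fun v hv hvb => (hqmax' v hv hvb).trans (by linarith)⟩
  · ext i
    simp only [Pi.sub_apply, Pi.add_apply, extendZero_apply]
    ring

/-- Compactness of the candidate set `K` lets one pair of prices rule out all compensations `δ₂` at
once; submodularity then exhibits a compensation these prices cannot rule out. -/
lemma isExchangeable_of_conj_isSubmodular (h : IsSubmodular (conj c)) (hp : IsProper c)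
    (hc : IsConvex c) (hl : LowerSemicontinuous c) : IsExchangeable c := by
  classical
  rw [isSubmodular_iff (conj_ne_bot hp)] at h
  rw [isExchangeable_iff hp.1]
  intro x hx y hy δ₁ hδ₁
  by_contra! hcon
  have hφ := convexOn_toReal hp.1 hc
  have hΦ : ConvexOn ℝ (effDom c ×ˢ effDom c)
      (fun z : (ι → ℝ) × (ι → ℝ) => (c z.1).toReal + (c z.2).toReal) := by
    refine ⟨hφ.1.prod hφ.1, fun u hu v hv α β hα hβ hαβ => ?_⟩
    have h1 := hφ.2 hu.1 hv.1 hα hβ hαβ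
    have h2 := hφ.2 hu.2 hv.2 hα hβ hαβ
    simp only [smul_eq_mul, Prod.fst_add, Prod.snd_add, Prod.smul_fst, Prod.smul_snd] at *
    linarith
  have hcl : IsClosed (epi (effDom c ×ˢ effDom c)
      (fun z : (ι → ℝ) × (ι → ℝ) => (c z.1).toReal + (c z.2).toReal)) := by
    convert (pairEpi_isClosed hp.1 hl).preimage
      (f := fun z : ((ι → ℝ) × (ι → ℝ)) × ℝ => (z.1.1, z.1.2, z.2)) (by fun_prop) using 1
    ext z
    simp [epi, pairEpi, and_assoc]
  set K : Set ((ι → ℝ) × (ι → ℝ)) :=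
    (fun δ₂ => (x - (δ₁ - δ₂), y + (δ₁ - δ₂))) '' Set.Icc 0 (x - y)⁻ with hK
  have hKcomp : IsCompact K := isCompact_Icc.image (by fun_prop)
  have hKconv : Convex ℝ K := by
    rintro _ ⟨u, hu, rfl⟩ _ ⟨v, hv, rfl⟩ α β hα hβ hαβ
    refine ⟨α • u + β • v, convex_Icc _ _ hu hv hα hβ hαβ, ?_⟩
    have : β = 1 - α := by linarith
    subst this
    ext1
    · simp only [Prod.fst_add, Prod.smul_fst]; module
    · simp only [Prod.snd_add, Prod.smul_snd]; module
  obtain ⟨l, b, hle, hlt⟩ := exists_affine_le_and_lt hΦ hcl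
    ⟨(x, x), hx, hx⟩ hKcomp hKconv (M := (c x).toReal + (c y).toReal) (by
      rintro _ ⟨δ₂, hδ₂, rfl⟩ hmem
      exact hcon δ₂ hδ₂ hmem.1 hmem.2)
  obtain ⟨p, hpl⟩ := exists_dotProduct_eq (l.comp (ContinuousLinearMap.inl ℝ (ι → ℝ) (ι → ℝ)))
  obtain ⟨p', hpl'⟩ := exists_dotProduct_eq (l.comp (ContinuousLinearMap.inr ℝ (ι → ℝ) (ι → ℝ)))
  have hlpp : ∀ u v, l (u, v) = p ⬝ᵥ u + p' ⬝ᵥ v := by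
    intro u v
    rw [← hpl, ← hpl']
    simp [← map_add]
  have hsum : ∀ u ∈ effDom c, ∀ v ∈ effDom c,
      (p ⬝ᵥ u - (c u).toReal) + (p' ⬝ᵥ v - (c v).toReal) ≤ b := by
    intro u hu v hv
    have := hle (u, v) ⟨hu, hv⟩
    rw [hlpp] at this
    simp only at this
    linarith
  have hpD : p ∈ effDom (conj c) :=
    (conj_toReal_le hp fun u hu => le_sub_iff_add_le.2 (hsum u hu x hx)).1
  obtain ⟨hpD', hle'⟩ := conj_toReal_le hp (p := p') (r := b - (conj c p).toReal) fun v hv => by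
    have := (conj_toReal_le hp fun u hu => le_sub_iff_add_le.2 (hsum u hu v hv)).2
    linarith
  obtain ⟨hinf, hsup, hsub⟩ := h p hpD p' hpD'
  have h1 := fenchel_young hp hsup hx
  have h2 := fenchel_young hp hinf hy
  -- Compensate fully exactly where shifting quantity from `y` to `x` lowers its value at prices
  -- `p'`, `p`; this keeps the value below that of `x`, `y` at `p ⊔ p'`, `p ⊓ p'`.
  set δ₂ : ι → ℝ := fun i => if p i < p' i then max (-(x i - y i)) 0 else 0 with hδ
  have h3 := hlt (x - (δ₁ - δ₂), y + (δ₁ - δ₂)) ⟨δ₂,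
    ⟨fun i => by simp only [hδ]; split_ifs <;> simp,
      fun i => by
        change δ₂ i ≤ max (-(x i - y i)) 0
        simp only [hδ]; split_ifs <;> simp⟩, rfl⟩
  rw [hlpp] at h3
  have h4 : p ⬝ᵥ (x - (δ₁ - δ₂)) + p' ⬝ᵥ (y + (δ₁ - δ₂)) ≤ (p ⊔ p') ⬝ᵥ x + (p ⊓ p') ⬝ᵥ y := by
    simp only [dotProduct, ← Finset.sum_add_distrib]
    refine Finset.sum_le_sum fun i _ => ?_
    have h7 : 0 ≤ δ₁ i := hδ₁.1 i
    have h8 : δ₁ i ≤ max (x i - y i) 0 := hδ₁.2 i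
    simp only [Pi.inf_apply, Pi.sup_apply, Pi.sub_apply, Pi.add_apply]
    by_cases hi : p i < p' i
    · have h9 : δ₂ i = max (-(x i - y i)) 0 := by simp [hδ, hi]
      rw [inf_eq_left.2 hi.le, sup_eq_right.2 hi.le, h9]
      rcases le_total (x i) (y i) with h10 | h10
      · rw [max_eq_left (by linarith)]
        rw [max_eq_right (by linarith)] at h8
        have : δ₁ i = 0 := le_antisymm h8 h7
        rw [this]
        nlinarith
      · rw [max_eq_right (by linarith)]
        rw [max_eq_left (by linarith)] at h8
        nlinarith
    · have h9 : δ₂ i = 0 := by simp [hδ, hi]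
      rw [inf_eq_right.2 (not_lt.1 hi), sup_eq_left.2 (not_lt.1 hi), h9]
      nlinarith
  linarith

lemma subdiff_setQLE_of_rejected (hp : IsProper c) (hc : IsConvex c)
    (hl : LowerSemicontinuous c) {p p' : ι → ℝ}
    (h : ∀ b, SetQLE (proj (agree p p') (rejected c p b)) (proj (agree p p') (rejected c p' b))) :
    SetQLE (proj (agree p p') (subdiff (conj c) p')) (proj (agree p p') (subdiff (conj c) p)) := by
  rintro _ ⟨x, hx, rfl⟩ _ ⟨y, hy, rfl⟩ δ₁ hδ₁
  rw [mem_subdiff_conj_iff hp hc hl] at hx hy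
  -- Both unconstrained maximizers fit under this capacity, so any constrained maximizer attains the
  -- unconstrained maximum.
  set b := x ⊔ y
  have hxb : x ≤ b := le_sup_left
  have hyb : y ≤ b := le_sup_right
  have e : ∀ i : agree p p', b i - y i - (b i - x i) = x i - y i := fun i => by ring
  obtain ⟨δ₂, hδ₂, ⟨_, ⟨q, hq, rfl⟩, hq1⟩, ⟨_, ⟨q', hq', rfl⟩, hq2⟩⟩ := h b
    (fun i => b i - y i) ⟨b - y, ⟨y, (mem_demand_iff hp.1).2
      ⟨hyb, hy.1, fun v hv _ => hy.2 v hv⟩, rfl⟩, rfl⟩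
    (fun i => b i - x i) ⟨b - x, ⟨x, (mem_demand_iff hp.1).2
      ⟨hxb, hx.1, fun v hv _ => hx.2 v hv⟩, rfl⟩, rfl⟩ δ₁
    ⟨hδ₁.1, fun i => (hδ₁.2 i).trans_eq (congrArg (fun t : ℝ => t⁺) (e i).symm)⟩
  rw [mem_demand_iff hp.1] at hq hq'
  refine ⟨δ₂, ⟨hδ₂.1, fun i => (hδ₂.2 i).trans_eq (congrArg (fun t : ℝ => t⁻) (e i))⟩,
    ⟨q', ?_, ?_⟩, ⟨q, ?_, ?_⟩⟩
  · exact (mem_subdiff_conj_iff hp hc hl).2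
      ⟨hq'.2.1, fun v hv => (hx.2 v hv).trans (hq'.2.2 x hx.1 hxb)⟩
  · ext i
    have := congrFun hq2 i
    simp only [Pi.sub_apply, Pi.add_apply] at this ⊢
    linarith
  · exact (mem_subdiff_conj_iff hp hc hl).2
      ⟨hq.2.1, fun v hv => (hy.2 v hv).trans (hq.2.2 y hy.1 hyb)⟩
  · ext i
    have := congrFun hq1 i
    simp only [Pi.sub_apply, Pi.add_apply] at this ⊢
    linarith

lemma conj_isSubmodular_of_subdiff (hp : IsProper c) (hc : IsConvex c)
    (hl : LowerSemicontinuous c) (h : ∀ p p' : ι → ℝ, p ≤ p' →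
      SetQLE (proj (agree p p') (subdiff (conj c) p')) (proj (agree p p') (subdiff (conj c) p))) :
    IsSubmodular (conj c) := by
  have hpc := conj_isProper hp hc hl
  have hS : SubExch (effDom (conj c)) (fun x => (conj c x).toReal) := by
    intro p p' hpp x hx y hy δ₁ hδ₁
    rw [← mem_subdiff_iff hpc] at hx hy
    obtain ⟨δ₂, hδ₂, ⟨x', hx', h1⟩, ⟨y', hy', h2⟩⟩ := h p p' hpp _ ⟨x, hx, rfl⟩ _ ⟨y, hy, rfl⟩
      (fun i => δ₁ i) ⟨fun i => (hδ₁ i).1, fun i => (hδ₁ i).2⟩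
    have hmem := extendZero_mem_Icc (v := (x - y)⁻) hδ₂ (fun i => le_rfl) (negPart_nonneg _)
    refine ⟨x', (mem_subdiff_iff hpc).1 hx', y', (mem_subdiff_iff hpc).1 hy', extendZero _ δ₂,
      fun i => ⟨hmem.1 i, ?_⟩, fun i hi => ?_⟩
    · rw [← neg_sub (x i) (y i)]; exact hmem.2 i
    · rw [extendZero_apply ⟨i, hi⟩]
      exact ⟨congrFun h1 ⟨i, hi⟩, congrFun h2 ⟨i, hi⟩⟩
  rw [isSubmodular_iff hpc.1]
  intro p hpD p' hpD'
  exact hS.submodular (convexOn_toReal hpc.1 (conj_isConvex hp.1))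
    (pairEpi_isClosed hpc.1 (conj_lowerSemicontinuous hp.1)) hpD hpD'

end Equivalence

end ExchangeMCS

theorem mainTheorem1 (n : ℕ) (c : (Fin n → ℝ) → EReal)
    (hproper : ExchangeMCS.IsProper c) (hconvex : ExchangeMCS.IsConvex c)
    (hlsc : LowerSemicontinuous c) :
    List.TFAE [
      ExchangeMCS.IsExchangeable c,
      ExchangeMCS.IsSubmodular (ExchangeMCS.conj c),
      ∀ p p' : Fin n → ℝ, p ≤ p' →
        ExchangeMCS.SetQLE
          (ExchangeMCS.proj (ExchangeMCS.agree p p')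
            (ExchangeMCS.subdiff (ExchangeMCS.conj c) p'))
          (ExchangeMCS.proj (ExchangeMCS.agree p p')
            (ExchangeMCS.subdiff (ExchangeMCS.conj c) p)),
      ∀ p qbar p' qbar' : Fin n → ℝ, p ≤ p' → qbar ≤ qbar' →
        ExchangeMCS.SetQLE
          (ExchangeMCS.proj (ExchangeMCS.agree p p') (ExchangeMCS.rejected c p qbar))
          (ExchangeMCS.proj (ExchangeMCS.agree p p') (ExchangeMCS.rejected c p' qbar'))] := by
  tfae_have 2 → 1 := fun h =>
    ExchangeMCS.isExchangeable_of_conj_isSubmodular h hproper hconvex hlsc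
  tfae_have 1 → 4 := fun h p qbar p' qbar' hpp hqq => h.rejected_setQLE hproper hpp hqq
  tfae_have 4 → 3 := fun h p p' hpp =>
    ExchangeMCS.subdiff_setQLE_of_rejected hproper hconvex hlsc fun b => h p b p' b hpp le_rfl
  tfae_have 3 → 2 := ExchangeMCS.conj_isSubmodular_of_subdiff hproper hconvex hlsc
  tfae_finish
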